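/- **Model.** Let $(\Omega,\mathcal F,\mathbb P)$ be a standard Borel probability space, let $\mu_l<\mu_h$ and $\sigma>0$, and let $\mu$ be a random state with values in $\{\mu_l,\mu_h\}$. Let $B,B^Y$ be standard Brownian motions such that $\mu$, $B$, $B^Y$ are independent. The fundamental process is $X_t=\mu t+\sigma B_t$, and $p_t$ is the continuous version of $\mathbb P(\mu=\mu_h\mid\sigma(X_s:s\le t))$. The sender's filtration $(\mathcal F^X_t)$ is the completion of the filtration generated by $X$ and the noise $B^Y$. Fix a threshold $\bar P\in(0,1)$, a continuous, convex, nondecreasing cost $c:[0,\infty)\to\mathbb R_+$ with $c(0)=0$, and $M\in[0,\infty]$. A *policy* $\pi=(g,\tau)$ consists of an $\mathcal F^X$-predictable garbling process $g$ that is bounded almost surely by a finite constant not exceeding $M$, with continuous signal $$Y^\pi_t=\int_0^t p_s\,ds+\int_0^t g_s\,dB^Y_s,$$ and an almost surely finite stopping time $\tau^\pi$ of $\mathcal F^{Y,\pi}_t=\sigma(Y^\pi_s:s\le t)$ with $\mathbb E[c(\tau^\pi)]<\infty$. Write $\hat p^\pi_{\tau^\pi}=\mathbb P(\mu=\mu_h\mid\mathcal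 F^{Y,\pi}_{\tau^\pi})$ for the receiver's posterior on stopping, and put $$Z^\pi=\mathbf 1_{\{\hat p^\pi_{\tau^\pi}\ge\bar P\}}-c(\tau^\pi),\qquad U(\pi)=\mathbb E[Z^\pi].$$ Let $\Pi$ be the set of policies. The global commitment value is $V^{\mathrm g}=\sup_{\pi\in\Pi}U(\pi)$, and $\pi$ is *globally optimal* if $U(\pi)=V^{\mathrm g}$. A policy $\pi$ is *sequentially optimal* if for every stopping time $\zeta$ of $(\mathcal F^{Y,\pi}_t)$ and every policy $\tilde\pi$ that coincides with $\pi$ up to $\zeta$ (almost surely, $Y^{\tilde\pi}_t=Y^\pi_t$ for all $t\le\zeta$, and $\tau^{\tilde\pi}\wedge\zeta=\tau^\pi\wedge\zeta$), $$\mathbb E[Z^\pi\mid\mathcal F^{Y,\pi}_\zeta]\ \ge\ \mathbb E[Z^{\tilde\pi}\mid\mathcal F^{Y,\pi}_\zeta]\qquad\text{a.s. on }\{\zeta<\tau^\pi\}.$$ The local commitment value is $V^{\mathrm l}=\sup\{U(\pi):\pi\in\Pi\text{ sequentially optimal}\}$. **Proposition.** Every globally optimal policy is sequentially optimal. Moreover,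 $V^{\mathrm g}=V^{\mathrm l}$ whenever a globally optimal policy exists, and conversely $V^{\mathrm g}=V^{\mathrm l}$ only if one exists. -/

import Mathlib

open MeasureTheory ProbabilityTheory
open scoped NNReal ENNReal

noncomputable section

/-- The `P`-completion of a filtration: each `𝓕 t` is enlarged by all `P`-null events. -/
def nullCompletion {Ω : Type*} {m : MeasurableSpace Ω} (𝓕 : Filtration ℝ≥0 m) (P : Measure Ω) :
    Filtration ℝ≥0 m where
  seq t := 𝓕 t ⊔ MeasurableSpace.generateFrom {N | MeasurableSet N ∧ P N = 0}
  mono' _ _ hst := sup_le_sup_right (𝓕.mono hst) _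
  le' t := sup_le (𝓕.le t) (MeasurableSpace.generateFrom_le fun _ hN => hN.1)

/-- A simple predictable process `∑ i < n, ξ i * 1_{(t i, t (i + 1)]}`, with `ξ i` bounded and
`𝓕 (t i)`-measurable. -/
structure SimplePredictable {Ω : Type*} {m : MeasurableSpace Ω} (𝓕 : Filtration ℝ≥0 m) where
  n : ℕ
  t : ℕ → ℝ≥0
  t_mono : Monotone t
  ξ : ℕ → Ω → ℝ
  ξ_meas : ∀ i, StronglyMeasurable[𝓕 (t i)] (ξ i)
  ξ_bdd : ∀ i, ∃ C : ℝ, ∀ ω, |ξ i ω| ≤ C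

namespace SimplePredictable

variable {Ω : Type*} {m : MeasurableSpace Ω} {𝓕 : Filtration ℝ≥0 m}

/-- The value of the simple process at time `s`. -/
def val (H : SimplePredictable 𝓕) (s : ℝ≥0) (ω : Ω) : ℝ :=
  ∑ i ∈ Finset.range H.n, (Set.Ioc (H.t i) (H.t (i + 1))).indicator (fun _ => H.ξ i ω) s

/-- The elementary stochastic integral `∫_0^T H dW`. -/
def integral (H : SimplePredictable 𝓕) (W : ℝ≥0 → Ω → ℝ) (T : ℝ≥0) (ω : Ω) : ℝ :=
  ∑ i ∈ Finset.range H.n, H.ξ i ω * (W (min (H.t (i + 1)) T) ω - W (min (H.t i) T) ω)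

end SimplePredictable

/-- `N` is (a version of) the Itô integral process `∫_0^· g dW` with respect to the Brownian motion
`W` of the filtration `𝓕`: there are simple predictable processes `H k` converging to `g` in
`L²([0,T] × Ω)` for every `T`, whose elementary integrals up to `T` converge to `N T` in `L²(Ω)`
for every `T`. -/
def IsItoIntegral {Ω : Type*} {m : MeasurableSpace Ω} (P : Measure Ω) (𝓕 : Filtration ℝ≥0 m)
    (W g N : ℝ≥0 → Ω → ℝ) : Prop :=
  ∃ H : ℕ → SimplePredictable 𝓕, ∀ T : ℝ≥0,
    Filter.Tendsto
      (fun k => ∫⁻ ω, (∫⁻ s in Set.Ioc (0 : ℝ) T,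
        ENNReal.ofReal (((H k).val s.toNNReal ω - g s.toNNReal ω) ^ 2)) ∂P)
      Filter.atTop (nhds 0) ∧
    Filter.Tendsto (fun k => eLpNorm (fun ω => (H k).integral W T ω - N T ω) 2 P)
      Filter.atTop (nhds 0)

/-- The primitives of the persuasion problem on a probability space `(Ω, P)`. -/
structure PersuasionModel (Ω : Type*) [MeasurableSpace Ω] (P : Measure Ω) where
  /-- drift in the high state -/
  muHigh : ℝ
  /-- drift in the low state -/
  muLow : ℝ
  muLow_lt : muLow < muHigh
  /-- volatility of the fundamental -/
  sigma : ℝ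
  sigma_pos : 0 < sigma
  /-- the random state, i.e. the drift of the fundamental -/
  state : Ω → ℝ
  state_meas : Measurable state
  state_mem : ∀ ω, state ω = muHigh ∨ state ω = muLow
  /-- the Brownian motion driving the fundamental -/
  B : ℝ≥0 → Ω → ℝ
  B_meas : ∀ t, Measurable (B t)
  B_brownian : IsBrownianReal B P
  /-- the Brownian motion driving the garbling noise -/
  BY : ℝ≥0 → Ω → ℝ
  BY_meas : ∀ t, Measurable (BY t)
  BY_brownian : IsBrownianReal BY P
  state_indep : IndepFun state (fun ω t => B t ω) P
  noise_indep : IndepFun (fun ω => (state ω, fun t => B t ω)) (fun ω t => BY t ω) P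
  /-- the sender's posterior: the continuous version of `P(state = muHigh | X_s, s ≤ t)`, where
  `X_t = state * t + sigma * B_t` -/
  p : ℝ≥0 → Ω → ℝ
  p_meas : ∀ t, Measurable (p t)
  p_cont : ∀ ω, Continuous fun t => p t ω
  p_condExp : ∀ t, p t =ᵐ[P]
    P[{ω | state ω = muHigh}.indicator (fun _ => (1 : ℝ)) |
      ⨆ s ≤ t, MeasurableSpace.comap (fun ω => state ω * s + sigma * B s ω) inferInstance]
  /-- the receiver's action threshold -/
  Pbar : ℝ
  Pbar_mem : Pbar ∈ Set.Ioo (0 : ℝ) 1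
  /-- the cost of delay, a function on `[0, ∞)` -/
  c : ℝ → ℝ
  c_cont : ContinuousOn c (Set.Ici 0)
  c_convex : ConvexOn ℝ (Set.Ici 0) c
  c_mono : MonotoneOn c (Set.Ici 0)
  c_zero : c 0 = 0
  /-- the bound on garblings; `M = ∞` allows every (finite) bound -/
  M : ℝ≥0∞

namespace PersuasionModel

variable {Ω : Type*} [MeasurableSpace Ω] {P : Measure Ω}

/-- The fundamental process `dX_t = state dt + sigma dB_t`. -/
def X (E : PersuasionModel Ω P) (t : ℝ≥0) (ω : Ω) : ℝ :=
  E.state ω * t + E.sigma * E.B t ω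

theorem X_meas (E : PersuasionModel Ω P) (t : ℝ≥0) : Measurable (E.X t) :=
  (E.state_meas.mul_const _).add ((E.B_meas t).const_mul _)

/-- The sender's filtration: the completion of the filtration generated by the fundamental and by
the noise that drives her signal. -/
def senderFiltration (E : PersuasionModel Ω P) : Filtration ℝ≥0 ‹MeasurableSpace Ω› :=
  nullCompletion (Filtration.natural (fun t ω => (E.X t ω, E.BY t ω))
    fun t => ((E.X_meas t).prodMk (E.BY_meas t)).stronglyMeasurable) P

/-- The indicator of the high state. -/
def high (E : PersuasionModel Ω P) : Ω → ℝ :=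
  {ω | E.state ω = E.muHigh}.indicator fun _ => 1

/-- A policy `π = (g, τ)` together with its signal process `Y`, `dY_t = p_t dt + g_t dB^Y_t`,
`Y_0 = 0`. -/
structure Policy (E : PersuasionModel Ω P) where
  /-- the garbling -/
  g : ℝ≥0 → Ω → ℝ
  g_pred : IsStronglyPredictable E.senderFiltration g
  g_bdd : ∃ K : ℝ≥0, (K : ℝ≥0∞) ≤ E.M ∧ ∀ᵐ ω ∂P, ∀ t, |g t ω| ≤ K
  /-- the signal -/
  Y : ℝ≥0 → Ω → ℝ
  Y_meas : ∀ t, Measurable (Y t)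
  Y_cont : ∀ ω, Continuous fun t => Y t ω
  Y_eq : IsItoIntegral P E.senderFiltration E.BY g
    fun t ω => Y t ω - ∫ s in (0 : ℝ)..t, E.p s.toNNReal ω
  /-- the time at which the interaction ends, a stopping time of `F^Y_t = σ(Y_s : s ≤ t)` -/
  τ : Ω → WithTop ℝ≥0
  τ_isStoppingTime : IsStoppingTime (Filtration.natural Y fun t => (Y_meas t).stronglyMeasurable) τ
  τ_finite : ∀ᵐ ω ∂P, τ ω < ⊤
  cost_int : Integrable (fun ω => E.c ((τ ω).untopD 0 : ℝ≥0)) P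

namespace Policy

variable {E : PersuasionModel Ω P}

/-- The receiver's filtration `F^Y_t = σ(Y_s : s ≤ t)`. -/
def signalFiltration (π : Policy E) : Filtration ℝ≥0 ‹MeasurableSpace Ω› :=
  Filtration.natural π.Y fun t => (π.Y_meas t).stronglyMeasurable

/-- The receiver's posterior when she is called to act,
`P(state = muHigh | F^Y_τ)`. -/
def posterior (π : Policy E) : Ω → ℝ :=
  P[E.high | π.τ_isStoppingTime.measurableSpace]

/-- The realized payoff `1{posterior ≥ Pbar} - c(τ)`. -/
def payoff (π : Policy E) (ω : Ω) : ℝ :=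
  {ω | E.Pbar ≤ π.posterior ω}.indicator (fun _ => (1 : ℝ)) ω - E.c ((π.τ ω).untopD 0 : ℝ≥0)

/-- The sender's expected payoff `U(π)`. -/
def U (π : Policy E) : ℝ := ∫ ω, π.payoff ω ∂P

/-- `π'` coincides with `π` up to time `ζ`. -/
def CoincidesUpTo (π' π : Policy E) (ζ : Ω → WithTop ℝ≥0) : Prop :=
  ∀ᵐ ω ∂P, (∀ t : ℝ≥0, (t : WithTop ℝ≥0) ≤ ζ ω → π'.Y t ω = π.Y t ω) ∧
    min (π'.τ ω) (ζ ω) = min (π.τ ω) (ζ ω)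

/-- Sequential optimality: at every stopping time `ζ` of the signal filtration of `π`, no policy
that coincides with `π` up to `ζ` has a better continuation on `{ζ < τ}`. -/
def SequentiallyOptimal (π : Policy E) : Prop :=
  ∀ (ζ : Ω → WithTop ℝ≥0) (hζ : IsStoppingTime π.signalFiltration ζ) (π' : Policy E),
    π'.CoincidesUpTo π ζ →
      ∀ᵐ ω ∂P, ζ ω < π.τ ω →
        (P[π'.payoff | hζ.measurableSpace]) ω ≤ (P[π.payoff | hζ.measurableSpace]) ω

end Policy

/-- The global commitment value. -/
def globalValue (E : PersuasionModel Ω P) : EReal :=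
  ⨆ π : Policy E, ((π.U : ℝ) : EReal)

/-- The local commitment value. -/
def localValue (E : PersuasionModel Ω P) : EReal :=
  ⨆ (π : Policy E) (_ : π.SequentiallyOptimal), ((π.U : ℝ) : EReal)

/-- Global optimality: `π` attains the global commitment value. -/
def Policy.GloballyOptimal {E : PersuasionModel Ω P} (π : Policy E) : Prop :=
  ((π.U : ℝ) : EReal) = E.globalValue

end PersuasionModel

end

/-! If a globally optimal `π` is beaten after `ζ` by some `π'` that coincides with it up to `ζ`, let
`A` be the event, known at `ζ`, on which `ζ < τ` and the conditional payoff of `π'` is strictly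
larger. Switching to `π'` at `ζ` on `A` changes the expected payoff by the integral over `A` of a
positive function. Global optimality makes this at most zero, so `A` is null.

The work is to show that the switched object is a policy with the payoff claimed. There are three
issues. (1) The pasted signal must be driven by the Itô integral of the pasted garbling
(`IsItoIntegral.paste`). The integral is only given as an L² limit of elementary integrals, so the
switching time is rounded up to a grid, elementary integrands are pasted there, and the overshoot is
controlled by the martingale property. (2) The receiver's filtration is raw, not completed, so
stopping times and stopped `σ`-algebras must be handled path by path. On a standard Borel space, a
measurable event that depends only on the path up to a stopping time belongs to the `σ`-algebra of
that time (Galmarino's test, from the separation of disjoint analytic sets). Policies coincide only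
almost surely, so the exceptional null event is marked by a signal that starts at 1 instead of 0 and
is thus visible at once. (3) The posterior of the switched policy must be that of `π'` on `A` and
that of `π` off `A`. Up to null sets the stopped `σ`-algebras have the same traces there
(`condExp_stopping_ae_eq_on_of_agreeUpTo`).

For the converse, every signal starts at 0 almost surely, so nothing is known at time 0 and all
policies coincide up to time 0. A sequentially optimal policy that does not stop at once almost
surely therefore beats every policy. Without a global optimum, all sequentially optimal policies
stop at once and share the payoff of `immediatePolicy`. If in addition the two values were equal,
that policy would be globally optimal. -/

noncomputable section

/-! ### Galmarino's test for raw filtrations of continuous paths -/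

/-- Blackwell separation: a measurable map from a standard Borel space that separates the points of
two measurable sets separates the sets by a measurable set of its codomain. -/
theorem exists_measurableSet_separating {Ω Z : Type*} [MeasurableSpace Ω] [StandardBorelSpace Ω]
    [MeasurableSpace Z] [StandardBorelSpace Z] {f : Ω → Z} (hf : Measurable f) {C D : Set Ω}
    (hC : MeasurableSet C) (hD : MeasurableSet D) (h : ∀ ω ∈ C, ∀ ω' ∈ D, f ω ≠ f ω') :
    ∃ B : Set Z, MeasurableSet B ∧ (∀ ω ∈ C, f ω ∈ B) ∧ ∀ ω ∈ D, f ω ∉ B := by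
  let _ := upgradeStandardBorel Z
  have hsep : MeasurablySeparable (f '' C) (f '' D) := by
    refine (hC.analyticSet_image hf).measurablySeparable (hD.analyticSet_image hf) ?_
    rw [Set.disjoint_left]
    rintro _ ⟨ω, hω, rfl⟩ ⟨ω', hω', he⟩
    exact h ω hω ω' hω' he.symm
  obtain ⟨B, hCB, hDB, hB⟩ := hsep
  exact ⟨B, hB, fun ω hω => hCB ⟨ω, hω, rfl⟩,
    fun ω hω hωB => Set.disjoint_left.1 hDB ⟨ω, hω, rfl⟩ hωB⟩

/-- The times up to which two paths are compared: `ω'` has the same path as `ω` up to `T`. -/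
def AgreeUpTo {Ω : Type*} (Y : ℝ≥0 → Ω → ℝ) (T : WithTop ℝ≥0) (ω ω' : Ω) : Prop :=
  ∀ s : ℝ≥0, (s : WithTop ℝ≥0) ≤ T → Y s ω = Y s ω'

namespace AgreeUpTo

variable {Ω : Type*} {Y : ℝ≥0 → Ω → ℝ} {S T : WithTop ℝ≥0} {ω ω' : Ω}

theorem symm (h : AgreeUpTo Y T ω ω') : AgreeUpTo Y T ω' ω := fun s hs => (h s hs).symm

theorem mono (h : AgreeUpTo Y T ω ω') (hST : S ≤ T) : AgreeUpTo Y S ω ω' :=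
  fun s hs => h s (hs.trans hST)

end AgreeUpTo

section Paths

/-- The time `s`, stopped at `T` if `T` is finite. -/
def clipTime (T : WithTop ℝ≥0) (s : ℝ≥0) : ℝ≥0 := if (s : WithTop ℝ≥0) ≤ T then s else T.untopD 0

theorem clipTime_of_le {T : WithTop ℝ≥0} {s : ℝ≥0} (h : (s : WithTop ℝ≥0) ≤ T) :
    clipTime T s = s := if_pos h

theorem clipTime_top (s : ℝ≥0) : clipTime ⊤ s = s := clipTime_of_le le_top

theorem clipTime_coe (z s : ℝ≥0) : clipTime z s = min s z := by
  by_cases hs : s ≤ z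
  · rw [clipTime_of_le (WithTop.coe_le_coe.2 hs), min_eq_left hs]
  · rw [clipTime, if_neg (fun h => hs (WithTop.coe_le_coe.1 h)), WithTop.untopD_coe,
      min_eq_right (not_le.1 hs).le]

theorem continuous_clipTime (T : WithTop ℝ≥0) : Continuous (clipTime T) := by
  induction T using WithTop.recTopCoe with
  | top => simpa only [funext clipTime_top] using continuous_id'
  | coe z => simpa only [funext (clipTime_coe z)] using continuous_id'.min continuous_const

theorem clipTime_le (T : WithTop ℝ≥0) (s : ℝ≥0) : (clipTime T s : WithTop ℝ≥0) ≤ T := by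
  induction T using WithTop.recTopCoe with
  | top => exact le_top
  | coe z => rw [clipTime_coe]; exact WithTop.coe_le_coe.2 (min_le_right _ _)

variable {Ω : Type*} {mΩ : MeasurableSpace Ω} {Y : ℝ≥0 → Ω → ℝ}

theorem measurable_clipTime {τ : Ω → WithTop ℝ≥0} (hτ : Measurable τ) (s : ℝ≥0) :
    Measurable fun ω => clipTime (τ ω) s :=
  Measurable.ite (measurableSet_le measurable_const hτ) measurable_const (hτ.untopD 0)

/-- A stopping time together with the path stopped at that time, sampled at a dense sequence. -/
def stoppedSample (Y : ℝ≥0 → Ω → ℝ) (τ : Ω → WithTop ℝ≥0) (ω : Ω) : (ℝ × ℝ≥0) × (ℕ → ℝ) :=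
  (({ω | τ ω = ⊤}.indicator (fun _ => (1 : ℝ)) ω, (τ ω).untopD 0),
    fun n => Y (clipTime (τ ω) (TopologicalSpace.denseSeq ℝ≥0 n)) ω)

/-- A continuous stopped path is determined by its values at a dense set of times. The indicator
coordinate is needed because `untopD 0` does not tell `⊤` from `0`. -/
theorem stoppedSample_eq_iff (hc : ∀ ω, Continuous fun t => Y t ω)
    {τ : Ω → WithTop ℝ≥0} {ω ω' : Ω} :
    stoppedSample Y τ ω = stoppedSample Y τ ω' ↔ τ ω = τ ω' ∧ AgreeUpTo Y (τ ω) ω ω' := by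
  constructor
  · intro h
    obtain ⟨⟨h1, h2⟩, h3⟩ : (_ ∧ _) ∧ _ := by
      simpa only [stoppedSample, Prod.mk.injEq] using h
    have hτ : τ ω = τ ω' := by
      rcases eq_or_ne (τ ω) ⊤ with h0 | h0 <;> rcases eq_or_ne (τ ω') ⊤ with h0' | h0'
      · rw [h0, h0']
      · simp [h0, h0'] at h1
      · simp [h0, h0'] at h1
      · obtain ⟨z, hz⟩ := WithTop.ne_top_iff_exists.1 h0
        obtain ⟨z', hz'⟩ := WithTop.ne_top_iff_exists.1 h0'
        rw [← hz, ← hz', WithTop.untopD_coe, WithTop.untopD_coe] at h2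
        rw [← hz, ← hz', h2]
    refine ⟨hτ, fun s hs => ?_⟩
    have key : (fun s => Y (clipTime (τ ω) s) ω) = fun s => Y (clipTime (τ ω) s) ω' := by
      refine Continuous.ext_on (TopologicalSpace.denseRange_denseSeq ℝ≥0)
        ((hc ω).comp (continuous_clipTime _)) ((hc ω').comp (continuous_clipTime _)) ?_
      rintro _ ⟨n, rfl⟩
      have := congrFun h3 n
      simp only [← hτ] at this
      exact this
    simpa only [clipTime_of_le hs] using congrFun key s
  · rintro ⟨hτ, h⟩
    simp only [stoppedSample, ← hτ, Set.indicator, Set.mem_ofPred_eq, Prod.mk.injEq, true_and]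
    funext n
    exact h _ (clipTime_le _ _)

theorem measurable_stoppedSample (hm : ∀ t, Measurable (Y t)) (hc : ∀ ω, Continuous fun t => Y t ω)
    {τ : Ω → WithTop ℝ≥0} (hτ : Measurable τ) : Measurable (stoppedSample Y τ) := by
  have hY : Measurable (Function.uncurry Y) := measurable_uncurry_of_continuous_of_measurable hc hm
  refine Measurable.prodMk (Measurable.prodMk ?_ (hτ.untopD 0)) (measurable_pi_iff.2 fun n => ?_)
  · exact measurable_const.indicator (hτ (measurableSet_singleton ⊤))
  · exact hY.comp ((measurable_clipTime hτ _).prodMk measurable_id)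

theorem measurable_stoppedSample_const {T : WithTop ℝ≥0}
    (h : ∀ s : ℝ≥0, (s : WithTop ℝ≥0) ≤ T → Measurable (Y s)) :
    Measurable (stoppedSample Y fun _ => T) :=
  (Measurable.prodMk (measurable_const.indicator (MeasurableSet.const _))
    measurable_const).prodMk (measurable_pi_iff.2 fun _ => h _ (clipTime_le _ _))

variable {hY : ∀ t, StronglyMeasurable (Y t)}

theorem mem_of_agreeUpTo_of_natural {t : ℝ≥0} {C : Set Ω}
    (hC : MeasurableSet[Filtration.natural Y hY t] C) {ω ω' : Ω} (h : AgreeUpTo Y t ω ω')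
    (hω : ω ∈ C) : ω' ∈ C := by
  rw [Filtration.natural_eq_comap] at hC
  obtain ⟨B, -, rfl⟩ := hC
  have : (fun j : Set.Iic t => Y j ω) = fun j : Set.Iic t => Y j ω' := by
    funext j
    exact h j (WithTop.coe_le_coe.2 j.2)
  simpa only [Set.mem_preimage, this] using hω

theorem mem_of_agreeUpTo_of_iSup_natural {C : Set Ω}
    (hC : MeasurableSet[⨆ t, Filtration.natural Y hY t] C) {ω ω' : Ω} (h : AgreeUpTo Y ⊤ ω ω')
    (hω : ω ∈ C) : ω' ∈ C := by
  have hle : ⨆ t, Filtration.natural Y hY t ≤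
      MeasurableSpace.comap (fun ω t => Y t ω) inferInstance := by
    refine iSup_le fun t => iSup₂_le fun s _ => ?_
    rintro _ ⟨B, hB, rfl⟩
    exact ⟨_, measurable_pi_apply s hB, rfl⟩
  obtain ⟨B, -, rfl⟩ := hle _ hC
  have : (fun t => Y t ω) = fun t => Y t ω' := by
    funext t
    exact h t le_top
  simpa only [Set.mem_preimage, this] using hω

/-- For `t ≤ τ ω` the event `{τ ≤ t}` depends only on the path up to `t`, on which the two outcomes
agree, so it cannot separate them. -/
theorem MeasureTheory.IsStoppingTime.eq_of_agreeUpTo {τ : Ω → WithTop ℝ≥0}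
    (hτ : IsStoppingTime (Filtration.natural Y hY) τ) {ω ω' : Ω}
    (h : AgreeUpTo Y (τ ω) ω ω') : τ ω' = τ ω := by
  have key : ∀ t : ℝ≥0, (t : WithTop ℝ≥0) ≤ τ ω → (τ ω ≤ t ↔ τ ω' ≤ t) := fun t ht =>
    ⟨fun h' => mem_of_agreeUpTo_of_natural (hτ t) (h.mono ht) h',
      fun h' => mem_of_agreeUpTo_of_natural (hτ t) (h.mono ht).symm h'⟩
  refine le_antisymm ?_ ?_
  · rcases eq_or_ne (τ ω) ⊤ with h0 | h0
    · rw [h0]; exact le_top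
    · lift τ ω to ℝ≥0 using h0 with z
      exact (key z le_rfl).1 le_rfl
  · by_contra! hlt
    have hne : τ ω' ≠ ⊤ := hlt.ne_top
    lift τ ω' to ℝ≥0 using hne with z
    exact absurd ((key z hlt.le).2 le_rfl) (not_le.2 hlt)

theorem MeasureTheory.IsStoppingTime.mem_of_agreeUpTo {τ : Ω → WithTop ℝ≥0}
    (hτ : IsStoppingTime (Filtration.natural Y hY) τ) {C : Set Ω}
    (hC : MeasurableSet[hτ.measurableSpace] C) {ω ω' : Ω}
    (h : AgreeUpTo Y (τ ω) ω ω') (hω : ω ∈ C) : ω' ∈ C := by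
  rcases eq_or_ne (τ ω) ⊤ with h0 | h0
  · exact mem_of_agreeUpTo_of_iSup_natural hC.1 (h0 ▸ h) hω
  · obtain ⟨z, hz⟩ := WithTop.ne_top_iff_exists.1 h0
    exact (mem_of_agreeUpTo_of_natural (hC.2 z) (hz ▸ h) ⟨hω, hz.ge⟩).1

variable [StandardBorelSpace Ω]

/-- Saturation means that the stopped sample never takes the same value on `C` and on its
complement, so Blackwell separation applies to this pair. -/
theorem measurableSet_comap_stoppedSample (hm : ∀ t, Measurable (Y t))
    (hc : ∀ ω, Continuous fun t => Y t ω)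
    {τ : Ω → WithTop ℝ≥0} (hτ : Measurable τ) {C : Set Ω} (hC : MeasurableSet C)
    (h : ∀ ω ω', τ ω = τ ω' → AgreeUpTo Y (τ ω) ω ω' → ω ∈ C → ω' ∈ C) :
    ∃ B, MeasurableSet B ∧ C = stoppedSample Y τ ⁻¹' B := by
  obtain ⟨B, hB, h1, h2⟩ := exists_measurableSet_separating
    (measurable_stoppedSample hm hc hτ) hC hC.compl
    (fun ω hω ω' hω' he => by
      rw [stoppedSample_eq_iff hc] at he
      exact hω' (h ω ω' he.1 he.2 hω))
  refine ⟨B, hB, Set.ext fun ω => ⟨h1 ω, fun hω => ?_⟩⟩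
  by_contra hn
  exact h2 ω hn hω

/-- Converse of `mem_of_agreeUpTo_of_natural`: ambient measurability and dependence on the path up
to `t` suffice. This is where the standard Borel hypothesis enters. -/
theorem measurableSet_natural_of_agreeUpTo (hc : ∀ ω, Continuous fun t => Y t ω) {t : ℝ≥0}
    {C : Set Ω} (hC : MeasurableSet C) (h : ∀ ω ω', AgreeUpTo Y t ω ω' → ω ∈ C → ω' ∈ C) :
    MeasurableSet[Filtration.natural Y hY t] C := by
  obtain ⟨B, hB, rfl⟩ := measurableSet_comap_stoppedSample (fun t => (hY t).measurable) hc
    (τ := fun _ => (t : WithTop ℝ≥0)) measurable_const hC (fun ω ω' _ => h ω ω')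
  have hm : Measurable[Filtration.natural Y hY t] (stoppedSample Y fun _ => (t : WithTop ℝ≥0)) := by
    refine @measurable_stoppedSample_const _ (Filtration.natural Y hY t) _ _ fun s hs => ?_
    exact ((Filtration.stronglyAdapted_natural hY s).mono
      ((Filtration.natural Y hY).mono (WithTop.coe_le_coe.1 hs))).measurable
  exact hm hB

theorem measurableSet_iSup_natural_of_agreeUpTo (hc : ∀ ω, Continuous fun t => Y t ω)
    {C : Set Ω} (hC : MeasurableSet C) (h : ∀ ω ω', AgreeUpTo Y ⊤ ω ω' → ω ∈ C → ω' ∈ C) :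
    MeasurableSet[⨆ t, Filtration.natural Y hY t] C := by
  obtain ⟨B, hB, rfl⟩ := measurableSet_comap_stoppedSample (fun t => (hY t).measurable) hc
    (τ := fun _ => (⊤ : WithTop ℝ≥0)) measurable_const hC (fun ω ω' _ => h ω ω')
  have hm : Measurable[⨆ t, Filtration.natural Y hY t]
      (stoppedSample Y fun _ => (⊤ : WithTop ℝ≥0)) := by
    refine @measurable_stoppedSample_const _ (⨆ t, Filtration.natural Y hY t) _ _ fun s _ => ?_
    exact ((Filtration.stronglyAdapted_natural hY s).mono
      (le_iSup (fun t => Filtration.natural Y hY t) s)).measurable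
  exact hm hB

theorem isStoppingTime_natural_of_agreeUpTo (hc : ∀ ω, Continuous fun t => Y t ω)
    {τ : Ω → WithTop ℝ≥0} (hτ : ∀ t : ℝ≥0, MeasurableSet {ω | τ ω ≤ t})
    (h : ∀ (t : ℝ≥0) ω ω', AgreeUpTo Y t ω ω' → τ ω ≤ t → τ ω' ≤ t) :
    IsStoppingTime (Filtration.natural Y hY) τ :=
  fun t => measurableSet_natural_of_agreeUpTo hc (hτ t) (h t)

theorem MeasureTheory.IsStoppingTime.measurableSet_of_agreeUpTo
    (hc : ∀ ω, Continuous fun t => Y t ω) {τ : Ω → WithTop ℝ≥0}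
    (hτ : IsStoppingTime (Filtration.natural Y hY) τ) {C : Set Ω} (hC : MeasurableSet C)
    (h : ∀ ω ω', AgreeUpTo Y (τ ω) ω ω' → ω ∈ C → ω' ∈ C) :
    MeasurableSet[hτ.measurableSpace] C := by
  refine ⟨measurableSet_iSup_natural_of_agreeUpTo hc hC fun ω ω' ha => h ω ω' (ha.mono le_top),
    fun t => measurableSet_natural_of_agreeUpTo hc
      (hC.inter ((Filtration.natural Y hY).le t _ (hτ t))) ?_⟩
  rintro ω ω' ha ⟨hω, hωt⟩
  exact ⟨h ω ω' (ha.mono hωt) hω, (hτ.eq_of_agreeUpTo (ha.mono hωt)).le.trans hωt⟩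

/-- A set that is determined by the path up to `τ` outside of an exceptional set `N` agrees outside
of `N` with an element of the `σ`-algebra of `τ`. -/
theorem MeasureTheory.IsStoppingTime.exists_measurableSet_of_agreeUpTo
    (hc : ∀ ω, Continuous fun t => Y t ω) {τ : Ω → WithTop ℝ≥0}
    (hτ : IsStoppingTime (Filtration.natural Y hY) τ) {C N : Set Ω} (hC : MeasurableSet C)
    (hN : MeasurableSet N)
    (h : ∀ ω ∈ C, ω ∉ N → ∀ ω' ∉ N, AgreeUpTo Y (τ ω) ω ω' → ω' ∈ C) :
    ∃ C', MeasurableSet[hτ.measurableSpace] C' ∧ ∀ ω ∉ N, (ω ∈ C' ↔ ω ∈ C) := by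
  have hm := measurable_stoppedSample (fun t => (hY t).measurable) hc
    (hτ.measurable.mono hτ.measurableSpace_le le_rfl)
  -- Points of `N` that lie in `C` or out of it are left in neither separated set, so their paths
  -- impose no condition.
  obtain ⟨B, hB, h1, h2⟩ := exists_measurableSet_separating hm (hC.diff hN) (hN.union hC).compl
    (fun ω hω ω' hω' he => by
      rw [stoppedSample_eq_iff hc] at he
      exact hω' (Or.inr (h ω hω.1 hω.2 ω' (fun h => hω' (Or.inl h)) he.2)))
  refine ⟨_, hτ.measurableSet_of_agreeUpTo hc (hm hB) fun ω ω' ha hω => ?_, fun ω hω =>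
    ⟨fun hωB => ?_, fun hωC => h1 ω ⟨hωC, hω⟩⟩⟩
  · have := (stoppedSample_eq_iff hc).2 ⟨(hτ.eq_of_agreeUpTo ha).symm, ha⟩
    rwa [Set.mem_preimage, ← this]
  · by_contra hn
    exact h2 ω (fun hu => hu.elim hω hn) hωB

end Paths

/-! ### Conditional expectation and null sets -/

section NullSets

variable {Ω : Type*}

/-- The sets that agree up to a null set with an element of the sub-`σ`-algebra `m`. -/
@[reducible] def nullCompleted (m : MeasurableSpace Ω) {m₀ : MeasurableSpace Ω} (P : Measure Ω) :
    MeasurableSpace Ω where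
  MeasurableSet' C := MeasurableSet C ∧ ∃ C', MeasurableSet[m] C' ∧ C =ᵐ[P] C'
  measurableSet_empty := ⟨@MeasurableSet.empty _ m₀, ∅, @MeasurableSet.empty _ m, .rfl⟩
  measurableSet_compl := by
    rintro C ⟨hC, C', hC', h⟩
    exact ⟨@MeasurableSet.compl _ _ m₀ hC, C'ᶜ, @MeasurableSet.compl _ _ m hC', h.compl⟩
  measurableSet_iUnion := by
    intro f hf
    choose hm g hg h using hf
    exact ⟨@MeasurableSet.iUnion _ _ m₀ _ _ hm, ⋃ i, g i, @MeasurableSet.iUnion _ _ m _ _ hg,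
      .countable_iUnion h⟩

variable {m m₀ : MeasurableSpace Ω} {P : Measure Ω}

theorem nullCompleted_le : nullCompleted m P ≤ m₀ := fun _ h => h.1

theorem le_nullCompleted (hm : m ≤ m₀) : m ≤ nullCompleted m P :=
  fun C h => ⟨hm C h, C, h, .rfl⟩

theorem sup_generateFrom_null_le (hm : m ≤ m₀) :
    m ⊔ MeasurableSpace.generateFrom {N | MeasurableSet N ∧ P N = 0} ≤ nullCompleted m P :=
  sup_le (le_nullCompleted hm) (MeasurableSpace.generateFrom_le fun _ hN =>
    ⟨hN.1, ∅, @MeasurableSet.empty _ m, ae_eq_empty.2 hN.2⟩)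

theorem condExp_nullCompleted [IsFiniteMeasure P] (hm : m ≤ m₀) {f : Ω → ℝ} (hf : Integrable f P) :
    P[f | nullCompleted m P] =ᵐ[P] P[f | m] := by
  refine (ae_eq_condExp_of_forall_setIntegral_eq nullCompleted_le hf
    (fun s _ _ => integrable_condExp.integrableOn) ?_
    (stronglyMeasurable_condExp.mono (le_nullCompleted hm)).aestronglyMeasurable).symm
  rintro s ⟨-, s', hs', h⟩ -
  rw [setIntegral_congr_set h, setIntegral_condExp hm hf hs', setIntegral_congr_set h]

/-- Conditional expectations agree on a set on which the `σ`-algebras agree up to null sets. -/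
theorem condExp_ae_eq_on_of_nullCompleted {m₁ m₂ m₀ : MeasurableSpace Ω} {P : Measure Ω}
    [IsFiniteMeasure P]
    (hm₁ : m₁ ≤ m₀) (hm₂ : m₂ ≤ m₀) {f : Ω → ℝ} (hf : Integrable f P) {D : Set Ω}
    (hD : MeasurableSet D)
    (h₁₂ : ∀ C, MeasurableSet[m₁] C → ∃ C', MeasurableSet[m₂] C' ∧ (C ∩ D : Set Ω) =ᵐ[P] C')
    (h₂₁ : ∀ C, MeasurableSet[m₂] C → ∃ C', MeasurableSet[m₁] C' ∧ (C ∩ D : Set Ω) =ᵐ[P] C') :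
    ∀ᵐ ω ∂P, ω ∈ D → (P[f | m₁]) ω = (P[f | m₂]) ω := by
  have key : ∀ {m₁ m₂ : MeasurableSpace Ω},
      (∀ C, MeasurableSet[m₁] C → ∃ C', MeasurableSet[m₂] C' ∧ (C ∩ D : Set Ω) =ᵐ[P] C') →
      ∀ t, MeasurableSet[nullCompleted m₁ P] (D ∩ t) → MeasurableSet[nullCompleted m₂ P] (D ∩ t) :=
        by
    rintro m₁ m₂ h t ⟨hm, C, hC, he⟩
    obtain ⟨C', hC', he'⟩ := h C hC
    refine ⟨hm, C', hC', .trans ?_ he'⟩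
    filter_upwards [he] with ω hω
    have : (ω ∈ D ∩ t) = (ω ∈ C) := hω
    have h' : (ω ∈ D ∩ t) = (ω ∈ C ∩ D) := by
      simp only [Set.mem_inter_iff, ← this, eq_iff_iff]; tauto
    exact h'
  -- `D` need not belong to `m₁`, only to its completion. This is why the comparison is carried out
  -- for the completed `σ`-algebras.
  have hD₁ : MeasurableSet[nullCompleted m₁ P] D := by
    obtain ⟨C', hC', he⟩ := h₂₁ Set.univ MeasurableSet.univ
    exact ⟨hD, C', hC', by simpa using he⟩
  have h := condExp_ae_eq_restrict_of_measurableSpace_eq_on (μ := P) (f := f)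
    (m := nullCompleted m₁ P) (m₂ := nullCompleted m₂ P) nullCompleted_le nullCompleted_le hD₁
    (fun t => ⟨key h₁₂ t, key h₂₁ t⟩)
  filter_upwards [ae_imp_of_ae_restrict h, condExp_nullCompleted hm₁ hf,
    condExp_nullCompleted hm₂ hf] with ω h0 h1 h2 hω
  rw [← h1, ← h2, h0 hω]

/-- Conditional expectation with respect to a trivial `σ`-algebra. -/
theorem condExp_ae_eq_integral_of_trivial [IsProbabilityMeasure P] (hm : m ≤ m₀) {f : Ω → ℝ}
    (hf : Integrable f P) (h : ∀ C, MeasurableSet[m] C → P C = 0 ∨ P Cᶜ = 0) :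
    P[f | m] =ᵐ[P] fun _ => ∫ ω, f ω ∂P := by
  refine (ae_eq_condExp_of_forall_setIntegral_eq hm hf
    (fun s _ _ => (integrable_const _).integrableOn) ?_ aestronglyMeasurable_const).symm
  intro s hs _
  rcases h s hs with h0 | h0
  · rw [Measure.restrict_eq_zero.2 h0]; simp
  · rw [setIntegral_congr_set (ae_eq_univ.2 h0), setIntegral_congr_set (ae_eq_univ.2 h0)]
    simp

end NullSets

/-! ### Comparison of stopped `σ`-algebras of two signals -/

section StoppedSigmaAlgebras

variable {Ω : Type*} [mΩ : MeasurableSpace Ω] [StandardBorelSpace Ω] {P : Measure Ω}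
  {Y₁ Y₂ : ℝ≥0 → Ω → ℝ} {hY₁ : ∀ t, StronglyMeasurable (Y₁ t)}
  {hY₂ : ∀ t, StronglyMeasurable (Y₂ t)} {τ₁ τ₂ : Ω → WithTop ℝ≥0}

/-- Off `N`, the `Y₂`-path up to `τ₂` decides `C ∩ D`: an outcome sharing that path with a point of
`C ∩ D` is in `D`, where both signals and both times coincide. Hence it shares the `Y₁`-path up to
`τ₁` as well and lies in `C`. -/
theorem exists_measurableSet_inter_of_agreeUpTo (hc₂ : ∀ ω, Continuous fun t => Y₂ t ω)
    (hτ₁ : IsStoppingTime (Filtration.natural Y₁ hY₁) τ₁)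
    (hτ₂ : IsStoppingTime (Filtration.natural Y₂ hY₂) τ₂) {D N : Set Ω} (hD : MeasurableSet D)
    (hN : MeasurableSet N) (hPN : P N = 0)
    (hτ : ∀ ω ∈ D, ω ∉ N → τ₁ ω = τ₂ ω)
    (hY : ∀ ω ∈ D, ω ∉ N → ∀ s : ℝ≥0, s ≤ τ₁ ω → Y₁ s ω = Y₂ s ω)
    (h₂ : ∀ ω ∈ D, ω ∉ N → ∀ ω' ∉ N, AgreeUpTo Y₂ (τ₂ ω) ω ω' → ω' ∈ D) {C : Set Ω}
    (hC : MeasurableSet[hτ₁.measurableSpace] C) :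
    ∃ C', MeasurableSet[hτ₂.measurableSpace] C' ∧ (C ∩ D : Set Ω) =ᵐ[P] C' := by
  obtain ⟨C', hC', h⟩ := hτ₂.exists_measurableSet_of_agreeUpTo hc₂
    ((hτ₁.measurableSpace_le _ hC).inter hD) hN (by
      rintro ω ⟨hω, hωD⟩ hωN ω' hωN' ha
      have hD' := h₂ ω hωD hωN ω' hωN' ha
      refine ⟨hτ₁.mem_of_agreeUpTo hC (fun s hs => ?_) hω, hD'⟩
      have hs' : s ≤ τ₁ ω' := by
        rw [hτ ω' hD' hωN', hτ₂.eq_of_agreeUpTo ha, ← hτ ω hωD hωN]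
        exact hs
      rw [hY ω hωD hωN s hs, hY ω' hD' hωN' s hs', ha s (hτ ω hωD hωN ▸ hs)])
  refine ⟨C', hC', ?_⟩
  filter_upwards [measure_eq_zero_iff_ae_notMem.1 hPN] with ω hω
  exact propext (h ω hω).symm

/-- This identifies the posterior after a switch: two policies with the same signal and stopping
time on `D` induce the same posterior there, provided that each signal reveals `D` by the time it is
stopped. -/
theorem condExp_stopping_ae_eq_on_of_agreeUpTo [IsFiniteMeasure P]
    (hc₁ : ∀ ω, Continuous fun t => Y₁ t ω)
    (hc₂ : ∀ ω, Continuous fun t => Y₂ t ω)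
    (hτ₁ : IsStoppingTime (Filtration.natural Y₁ hY₁) τ₁)
    (hτ₂ : IsStoppingTime (Filtration.natural Y₂ hY₂) τ₂) {D N : Set Ω} (hD : MeasurableSet D)
    (hN : MeasurableSet N) (hPN : P N = 0)
    (hτ : ∀ ω ∈ D, ω ∉ N → τ₁ ω = τ₂ ω)
    (hY : ∀ ω ∈ D, ω ∉ N → ∀ s : ℝ≥0, s ≤ τ₁ ω → Y₁ s ω = Y₂ s ω)
    (h₁ : ∀ ω ∈ D, ω ∉ N → ∀ ω' ∉ N, AgreeUpTo Y₁ (τ₁ ω) ω ω' → ω' ∈ D)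
    (h₂ : ∀ ω ∈ D, ω ∉ N → ∀ ω' ∉ N, AgreeUpTo Y₂ (τ₂ ω) ω ω' → ω' ∈ D)
    {f : Ω → ℝ} (hf : Integrable f P) :
    ∀ᵐ ω ∂P, ω ∈ D → (P[f | hτ₁.measurableSpace]) ω = (P[f | hτ₂.measurableSpace]) ω :=
  condExp_ae_eq_on_of_nullCompleted hτ₁.measurableSpace_le hτ₂.measurableSpace_le hf hD
    (fun _ hC => exists_measurableSet_inter_of_agreeUpTo hc₂ hτ₁ hτ₂ hD hN hPN hτ hY h₂ hC)
    (fun _ hC => exists_measurableSet_inter_of_agreeUpTo hc₁ hτ₂ hτ₁ hD hN hPN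
      (fun ω hω hωN => (hτ ω hω hωN).symm)
      (fun ω hω hωN s hs => (hY ω hω hωN s (hs.trans_eq (hτ ω hω hωN).symm)).symm) h₁ hC)

omit [StandardBorelSpace Ω] in
/-- If the path starts almost surely at `0`, the `σ`-algebra of a stopping time that vanishes almost
surely is trivial. -/
theorem condExp_stopping_ae_eq_integral [IsProbabilityMeasure P]
    (hτ₁ : IsStoppingTime (Filtration.natural Y₁ hY₁) τ₁) (h0 : ∀ᵐ ω ∂P, τ₁ ω =
      ((0 : ℝ≥0) : WithTop ℝ≥0))
    (hY0 : ∀ᵐ ω ∂P, Y₁ 0 ω = 0) {f : Ω → ℝ} (hf : Integrable f P) :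
    P[f | hτ₁.measurableSpace] =ᵐ[P] fun _ => ∫ ω, f ω ∂P := by
  refine condExp_ae_eq_integral_of_trivial hτ₁.measurableSpace_le hf fun C hC => ?_
  -- All regular outcomes share the same path up to time 0, so one of them in `C` brings in all the
  -- others.
  by_cases hex : ∃ ω₀ ∈ C, τ₁ ω₀ = ((0 : ℝ≥0) : WithTop ℝ≥0) ∧ Y₁ 0 ω₀ = 0
  · right
    obtain ⟨ω₀, hω₀, ht, hy⟩ := hex
    rw [← mem_ae_iff]
    filter_upwards [h0, hY0] with ω h1 h2
    refine hτ₁.mem_of_agreeUpTo hC (fun s hs => ?_) hω₀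
    rw [ht] at hs
    obtain rfl : s = 0 := by simpa using WithTop.coe_le_coe.1 hs
    rw [hy, h2]
  · left
    rw [measure_eq_zero_iff_ae_notMem]
    filter_upwards [h0, hY0] with ω h1 h2 hω
    exact hex ⟨ω, hω, h1, h2⟩

end StoppedSigmaAlgebras

/-! ### Independence of the sender's past and the future noise -/

section Independence

variable {Ω : Type*} {m₀ : MeasurableSpace Ω} {P : Measure Ω}

theorem ProbabilityTheory.Indep.nullCompleted_left {m₁ m₂ : MeasurableSpace Ω}
    (h : Indep m₁ m₂ P) : Indep (nullCompleted m₁ P) m₂ P := by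
  rw [Indep_iff] at h ⊢
  rintro C D ⟨-, C', hC', he⟩ hD
  rw [measure_congr he, ← h C' D hC' hD]
  exact measure_congr (he.inter .rfl)

/-- If `m₁` is independent of `m₂ ⊔ m₃` and `m₂` is independent of `m₃`, then `m₁ ⊔ m₂` is
independent of `m₃`. -/
theorem ProbabilityTheory.Indep.sup_of_indep_sup [IsProbabilityMeasure P]
    {m₁ m₂ m₃ m : MeasurableSpace Ω}
    (h₁ : m₁ ≤ m₀) (hm : m ≤ m₀) (h₂ : m₂ ≤ m) (h₃ : m₃ ≤ m) (h : Indep m₁ m P)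
    (h' : Indep m₂ m₃ P) : Indep (m₁ ⊔ m₂) m₃ P := by
  have hpi : m₁ ⊔ m₂ = MeasurableSpace.generateFrom
      {C | ∃ A, MeasurableSet[m₁] A ∧ ∃ B, MeasurableSet[m₂] B ∧ A ∩ B = C} := by
    refine le_antisymm (sup_le ?_ ?_) (MeasurableSpace.generateFrom_le ?_)
    · exact fun A hA => MeasurableSpace.measurableSet_generateFrom
        ⟨A, hA, Set.univ, @MeasurableSet.univ _ m₂, Set.inter_univ A⟩
    · exact fun B hB => MeasurableSpace.measurableSet_generateFrom
        ⟨Set.univ, @MeasurableSet.univ _ m₁, B, hB, Set.univ_inter B⟩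
    · rintro _ ⟨A, hA, B, hB, rfl⟩
      exact @MeasurableSet.inter _ (m₁ ⊔ m₂) _ _ ((le_sup_left : m₁ ≤ m₁ ⊔ m₂) _ hA)
        ((le_sup_right : m₂ ≤ m₁ ⊔ m₂) _ hB)
  refine IndepSets.indep (sup_le h₁ (h₂.trans hm)) (h₃.trans hm) ?_
    (@MeasurableSpace.isPiSystem_measurableSet _ m₃) hpi
    (@MeasurableSpace.generateFrom_measurableSet _ m₃).symm ?_
  · rintro _ ⟨A, hA, B, hB, rfl⟩ _ ⟨A', hA', B', hB', rfl⟩ -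
    exact ⟨A ∩ A', @MeasurableSet.inter _ m₁ _ _ hA hA', B ∩ B',
      @MeasurableSet.inter _ m₂ _ _ hB hB', Set.inter_inter_inter_comm _ _ _ _⟩
  · rw [IndepSets_iff]
    rintro _ D ⟨A, hA, B, hB, rfl⟩ hD
    rw [Indep_iff] at h h'
    rw [Set.inter_assoc, h A _ hA (@MeasurableSet.inter _ m _ _ (h₂ _ hB) (h₃ _ hD)),
      h' B D hB hD, h A B hA (h₂ _ hB), mul_assoc]

end Independence

namespace PersuasionModel

variable {Ω : Type*} [mΩ : MeasurableSpace Ω] {P : Measure Ω}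

/-- Independence survives if the sender is given the state and the whole path of `B` in advance,
which leaves `BY` as the only source with a time structure. -/
theorem senderFiltration_le_nullCompleted (E : PersuasionModel Ω P) (s : ℝ≥0) :
    E.senderFiltration s ≤ nullCompleted
      (MeasurableSpace.comap (fun ω => (E.state ω, fun t => E.B t ω)) inferInstance ⊔
        MeasurableSpace.comap (fun ω (t : Set.Iic s) => E.BY t ω) inferInstance) P := by
  have hX : MeasurableSpace.comap (fun ω => (E.state ω, fun t => E.B t ω)) inferInstance ≤ mΩ :=
    (E.state_meas.prodMk (measurable_pi_iff.2 E.B_meas)).comap_le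
  have hY : MeasurableSpace.comap (fun ω (t : Set.Iic s) => E.BY t ω) inferInstance ≤ mΩ :=
    Measurable.comap_le (measurable_pi_iff.2 fun t => E.BY_meas t)
  have h1 := (comap_measurable (m := inferInstance) fun ω => (E.state ω, fun t => E.B t ω)).mono
    (le_sup_left (b := MeasurableSpace.comap (fun ω (t : Set.Iic s) => E.BY t ω) inferInstance))
    le_rfl
  have h2 := (comap_measurable (m := inferInstance) fun ω (t : Set.Iic s) => E.BY t ω).mono
    (le_sup_right (a := MeasurableSpace.comap (fun ω => (E.state ω, fun t => E.B t ω))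
      inferInstance)) le_rfl
  refine sup_le ((iSup₂_le fun r hr => ?_).trans (le_nullCompleted (sup_le hX hY)))
    (le_sup_right.trans (sup_generateFrom_null_le (sup_le hX hY)))
  have hX' : Measurable fun x : ℝ × (ℝ≥0 → ℝ) => x.1 * r + E.sigma * x.2 r := by fun_prop
  exact ((hX'.comp h1).prodMk ((measurable_pi_apply (⟨r, hr⟩ : Set.Iic s)).comp h2)).comap_le

/-- The pair of state and `B` is independent of the whole of `BY`, and the increment of `BY` is
independent of the past of `BY`. `Indep.sup_of_indep_sup` combines the two. -/
theorem indep_senderFiltration_increment [IsProbabilityMeasure P] (E : PersuasionModel Ω P)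
    {s t : ℝ≥0} (hst : s ≤ t) :
    Indep (E.senderFiltration s)
      (MeasurableSpace.comap (fun ω => E.BY t ω - E.BY s ω) inferInstance) P := by
  refine indep_of_indep_of_le_left (Indep.nullCompleted_left ?_)
    (E.senderFiltration_le_nullCompleted s)
  have hBY : Measurable fun ω t => E.BY t ω := measurable_pi_iff.2 E.BY_meas
  have hle : MeasurableSpace.comap (fun ω t => E.BY t ω) inferInstance ≤ mΩ := hBY.comap_le
  have hc : Measurable[MeasurableSpace.comap (fun ω t => E.BY t ω) inferInstance]
    fun ω t => E.BY t ω := comap_measurable _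
  have hinc : Indep (MeasurableSpace.comap (fun ω (t : Set.Iic s) => E.BY t ω) inferInstance)
      (MeasurableSpace.comap (fun ω => E.BY t ω - E.BY s ω) inferInstance) P := by
    have h := (E.BY_brownian.toIsPreBrownianReal.indepFun_shift s).symm
    have hev : Measurable fun f : ℝ≥0 → ℝ => f (t - s) := by fun_prop
    have h' := IndepFun.comp h measurable_id hev
    have he : ((fun f : ℝ≥0 → ℝ => f (t - s)) ∘ fun ω t => E.BY (s + t) ω - E.BY s ω) =
        fun ω => E.BY t ω - E.BY s ω := by
      funext ω
      simp only [Function.comp, add_tsub_cancel_of_le hst]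
    rw [he] at h'
    exact h'
  refine Indep.sup_of_indep_sup
    (E.state_meas.prodMk (measurable_pi_iff.2 E.B_meas)).comap_le hle ?_ ?_
    E.noise_indep hinc
  · exact (@Measurable.comap_le _ _ (_) _ _
      (@measurable_pi_lambda _ _ _ (_) _ _ fun t => (measurable_pi_apply (t : ℝ≥0)).comp hc))
  · exact Measurable.comap_le (((measurable_pi_apply t).comp hc).sub
      ((measurable_pi_apply s).comp hc))

end PersuasionModel

/-! ### Square-integrable martingales -/

/-- A square-integrable adapted process with centered increments independent of the past. -/
structure HasCenteredIndepIncrements {Ω : Type*} {m : MeasurableSpace Ω} (W : ℝ≥0 → Ω → ℝ)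
    (𝓕 : Filtration ℝ≥0 m) (P : Measure Ω) : Prop where
  stronglyMeasurable : ∀ t, StronglyMeasurable[𝓕 t] (W t)
  memLp : ∀ t, MemLp (W t) 2 P
  integral_eq_zero : ∀ t, ∫ ω, W t ω ∂P = 0
  indep : ∀ s t, s ≤ t →
    Indep (𝓕 s) (MeasurableSpace.comap (fun ω => W t ω - W s ω) inferInstance) P

theorem PersuasionModel.hasCenteredIndepIncrements {Ω : Type*} [mΩ : MeasurableSpace Ω]
    {P : Measure Ω} [IsProbabilityMeasure P] (E : PersuasionModel Ω P) :
    HasCenteredIndepIncrements E.BY E.senderFiltration P where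
  stronglyMeasurable t := by
    have h := Filtration.stronglyAdapted_natural (u := fun t ω => (E.X t ω, E.BY t ω))
      (fun t => ((E.X_meas t).prodMk (E.BY_meas t)).stronglyMeasurable) t
    have h' : Measurable[E.senderFiltration t] (E.BY t) :=
      (measurable_snd.comp h.measurable).mono le_sup_left le_rfl
    exact h'.stronglyMeasurable
  memLp t := (E.BY_brownian.hasLaw_eval t).hasGaussianLaw.memLp_two
  integral_eq_zero t := E.BY_brownian.integral_eval t
  indep s t hst := E.indep_senderFiltration_increment hst

/-- A square-integrable process that satisfies the martingale identity almost surely. -/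
structure IsL2Martingale {Ω : Type*} {m : MeasurableSpace Ω} (𝓕 : Filtration ℝ≥0 m)
    (P : Measure Ω) (M : ℝ≥0 → Ω → ℝ) : Prop where
  memLp : ∀ t, MemLp (M t) 2 P
  condExp : ∀ r t, r ≤ t → P[M t | 𝓕 r] =ᵐ[P] M r

namespace IsL2Martingale

variable {Ω : Type*} {m : MeasurableSpace Ω} {𝓕 : Filtration ℝ≥0 m} {P : Measure Ω}
  [IsFiniteMeasure P] {M N : ℝ≥0 → Ω → ℝ}

theorem integrable (h : IsL2Martingale 𝓕 P M) (t : ℝ≥0) : Integrable (M t) P :=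
  (h.memLp t).integrable one_le_two

omit [IsFiniteMeasure P] in
theorem zero : IsL2Martingale 𝓕 P fun _ _ => 0 where
  memLp _ := MemLp.zero'
  condExp r t _ := by rw [show (fun _ : Ω => (0 : ℝ)) = 0 from rfl, condExp_zero]

theorem add (hM : IsL2Martingale 𝓕 P M) (hN : IsL2Martingale 𝓕 P N) :
    IsL2Martingale 𝓕 P fun t ω => M t ω + N t ω where
  memLp t := (hM.memLp t).add (hN.memLp t)
  condExp r t hrt := (condExp_add (hM.integrable t) (hN.integrable t) _).trans
    ((hM.condExp r t hrt).add (hN.condExp r t hrt))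

theorem sub (hM : IsL2Martingale 𝓕 P M) (hN : IsL2Martingale 𝓕 P N) :
    IsL2Martingale 𝓕 P fun t ω => M t ω - N t ω where
  memLp t := (hM.memLp t).sub (hN.memLp t)
  condExp r t hrt := (condExp_sub (hM.integrable t) (hN.integrable t) _).trans
    ((hM.condExp r t hrt).sub (hN.condExp r t hrt))

theorem sum {ι : Type*} {S : Finset ι} {f : ι → ℝ≥0 → Ω → ℝ}
    (h : ∀ i ∈ S, IsL2Martingale 𝓕 P (f i)) :
    IsL2Martingale 𝓕 P fun t ω => ∑ i ∈ S, f i t ω := by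
  classical
  induction S using Finset.induction_on with
  | empty => simpa using zero
  | insert i S hi ih =>
    simp only [Finset.sum_insert hi]
    exact (h i (Finset.mem_insert_self i S)).add
      (ih fun j hj => h j (Finset.mem_insert_of_mem hj))

/-- The second moments of a martingale on an event increase after the event becomes known. -/
theorem eLpNorm_restrict_le (h : IsL2Martingale 𝓕 P M) {r t : ℝ≥0} (hrt : r ≤ t) {F : Set Ω}
    (hF : MeasurableSet[𝓕 r] F) :
    eLpNorm (M r) 2 (P.restrict F) ≤ eLpNorm (M t) 2 (P.restrict F) := by
  have hFm : MeasurableSet F := 𝓕.le r F hF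
  rw [← eLpNorm_indicator_eq_eLpNorm_restrict hFm, ← eLpNorm_indicator_eq_eLpNorm_restrict hFm]
  have he : F.indicator (M r) =ᵐ[P] P[F.indicator (M t) | 𝓕 r] := by
    filter_upwards [h.condExp r t hrt, condExp_indicator (h.integrable t) hF] with ω h1 h2
    rw [h2]
    by_cases hω : ω ∈ F
    · rw [Set.indicator_of_mem hω, Set.indicator_of_mem hω, h1]
    · rw [Set.indicator_of_notMem hω, Set.indicator_of_notMem hω]
  rw [eLpNorm_congr_ae he]
  exact eLpNorm_condExp_le_eLpNorm _ one_le_two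

/-- Conditional expectation contracts the L² norm, so the martingale identity passes to L² limits.
Adaptedness of the limit is not asked for, since the limit is only determined up to null sets. -/
theorem of_tendsto {M' : ℕ → ℝ≥0 → Ω → ℝ} (h : ∀ k, IsL2Martingale 𝓕 P (M' k))
    (hM : ∀ t, AEStronglyMeasurable (M t) P)
    (hlim : ∀ t, Filter.Tendsto (fun k => eLpNorm (fun ω => M' k t ω - M t ω) 2 P)
      Filter.atTop (nhds 0)) : IsL2Martingale 𝓕 P M := by
  have hmem : ∀ t, MemLp (M t) 2 P := fun t => by
    obtain ⟨k, hk⟩ := ((hlim t).eventually (gt_mem_nhds ENNReal.zero_lt_top)).exists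
    have hd : MemLp (fun ω => M' k t ω - M t ω) 2 P :=
      ⟨((h k).memLp t).1.sub (hM t), hk⟩
    have := ((h k).memLp t).sub hd
    refine this.ae_eq (.of_forall fun ω => ?_)
    simp
  refine ⟨hmem, fun r t hrt => ?_⟩
  have key : ∀ k, eLpNorm (fun ω => (P[M t | 𝓕 r]) ω - M r ω) 2 P ≤
      eLpNorm (fun ω => M' k t ω - M t ω) 2 P + eLpNorm (fun ω => M' k r ω - M r ω) 2 P := by
    intro k
    have hint : Integrable (M t) P := (hmem t).integrable one_le_two
    let A : Ω → ℝ := fun ω => M' k r ω - M r ω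
    let B : Ω → ℝ := fun ω => M' k t ω - M t ω
    have he : (fun ω => (P[M t | 𝓕 r]) ω - M r ω) =ᵐ[P] A - P[B | 𝓕 r] := by
      filter_upwards [condExp_sub ((h k).integrable t) hint (𝓕 r), (h k).condExp r t hrt]
        with ω h1 h2
      have h3 : (P[B | 𝓕 r]) ω = (P[M' k t | 𝓕 r]) ω - (P[M t | 𝓕 r]) ω := h1
      rw [Pi.sub_apply, h3, h2]
      simp only [A]
      ring
    have hA : AEStronglyMeasurable A P := ((h k).memLp r).1.sub (hM r)
    calc _ = eLpNorm (A - P[B | 𝓕 r]) 2 P := eLpNorm_congr_ae he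
      _ ≤ eLpNorm A 2 P + eLpNorm (P[B | 𝓕 r]) 2 P :=
        eLpNorm_sub_le hA integrable_condExp.aestronglyMeasurable one_le_two
      _ ≤ eLpNorm A 2 P + eLpNorm B 2 P :=
        add_le_add_right (eLpNorm_condExp_le_eLpNorm _ one_le_two) _
      _ = _ := add_comm _ _
  have hz : eLpNorm (fun ω => (P[M t | 𝓕 r]) ω - M r ω) 2 P = 0 := by
    refine le_antisymm (ge_of_tendsto' (x := Filter.atTop) ?_ key) zero_le
    simpa using (hlim t).add (hlim r)
  rw [eLpNorm_eq_zero_iff (f := fun ω => (P[M t | 𝓕 r]) ω - M r ω)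
    (integrable_condExp.aestronglyMeasurable.sub (hM r)) two_ne_zero] at hz
  filter_upwards [hz] with ω hω
  exact sub_eq_zero.1 hω

end IsL2Martingale

/-! ### Itô integrals are martingales -/

section Elementary

variable {Ω : Type*} {m : MeasurableSpace Ω} {𝓕 : Filtration ℝ≥0 m} {P : Measure Ω}
  [IsProbabilityMeasure P] {W : ℝ≥0 → Ω → ℝ}

theorem HasCenteredIndepIncrements.condExp_mul_sub (hW : HasCenteredIndepIncrements W 𝓕 P)
    {r s t : ℝ≥0} (hrs : r ≤ s) (hst : s ≤ t) {ξ : Ω → ℝ} (hξ : StronglyMeasurable[𝓕 s] ξ)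
    {C : ℝ} (hC : ∀ ω, |ξ ω| ≤ C) :
    P[fun ω => ξ ω * (W t ω - W s ω) | 𝓕 r] =ᵐ[P] 0 := by
  have hint : Integrable (fun ω => W t ω - W s ω) P :=
    ((hW.memLp t).sub (hW.memLp s)).integrable one_le_two
  have hinc : P[fun ω => W t ω - W s ω | 𝓕 s] =ᵐ[P] 0 := by
    have hle : MeasurableSpace.comap (fun ω => W t ω - W s ω) inferInstance ≤ m :=
      (((hW.stronglyMeasurable t).mono (𝓕.le t)).measurable.sub
        ((hW.stronglyMeasurable s).mono (𝓕.le s)).measurable).comap_le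
    refine (condExp_indep_eq hle (𝓕.le s) (comap_measurable _).stronglyMeasurable
      (hW.indep s t hst).symm).trans ?_
    rw [integral_sub ((hW.memLp t).integrable one_le_two) ((hW.memLp s).integrable one_le_two),
      hW.integral_eq_zero, hW.integral_eq_zero, sub_zero]
    rfl
  have hs : P[fun ω => ξ ω * (W t ω - W s ω) | 𝓕 s] =ᵐ[P] 0 := by
    refine (condExp_stronglyMeasurable_mul_of_bound (𝓕.le s) hξ hint C
      (.of_forall hC)).trans ?_
    filter_upwards [hinc] with ω hω
    simp [hω]
  refine (condExp_condExp_of_le (𝓕.mono hrs) (𝓕.le s)).symm.trans ?_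
  refine (condExp_congr_ae hs).trans ?_
  rw [condExp_zero]

theorem HasCenteredIndepIncrements.isL2Martingale_interval
    (hW : HasCenteredIndepIncrements W 𝓕 P) {a b : ℝ≥0} (hab : a ≤ b) {ξ : Ω → ℝ}
    (hξ : StronglyMeasurable[𝓕 a] ξ) (hb : ∃ C : ℝ, ∀ ω, |ξ ω| ≤ C) :
    IsL2Martingale 𝓕 P fun t ω => ξ ω * (W (min b t) ω - W (min a t) ω) := by
  obtain ⟨C, hC⟩ := hb
  have hmem : ∀ s t, MemLp (fun ω => ξ ω * (W t ω - W s ω)) 2 P := fun s t => by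
    have h1 : MemLp ξ ∞ P := memLp_top_of_bound (hξ.mono (𝓕.le a)).aestronglyMeasurable C
      (.of_forall hC)
    exact ((hW.memLp t).sub (hW.memLp s)).mul h1
  refine ⟨fun t => hmem _ _, fun r t hrt => ?_⟩
  -- The first summand is what has accrued by time `r`. The second is an increment over times after
  -- both `a` and `r`, hence centered given `𝓕 r`. The outer `max` collapses its interval when `min
  -- b t` comes before `max a r`.
  have hdec : (fun ω => ξ ω * (W (min b t) ω - W (min a t) ω)) =
      (fun ω => ξ ω * (W (min b r) ω - W (min a r) ω)) +
        fun ω => ξ ω * (W (max (max a r) (min b t)) ω - W (max a r) ω) := by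
    funext ω
    simp only [Pi.add_apply]
    rw [← mul_add]
    congr 1
    rcases le_total (min b t) (max a r) with h | h
    · rw [max_eq_left h]
      rcases min_le_iff.1 h with h | h
      · rcases le_max_iff.1 h with h' | h'
        · obtain rfl := le_antisymm hab h'
          simp
        · rw [min_eq_left h', min_eq_left (h'.trans hrt), min_eq_left (hab.trans h'),
            min_eq_left (hab.trans (h'.trans hrt))]
          ring
      · rcases le_max_iff.1 h with h' | h'
        · rw [min_eq_right h', min_eq_right (h'.trans hab), min_eq_right (hrt.trans h'),
            min_eq_right (hrt.trans (h'.trans hab))]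
          ring
        · obtain rfl := le_antisymm hrt h'
          simp
    · rw [max_eq_right h]
      have hrb : r ≤ b := (le_max_right a r).trans (h.trans (min_le_left _ _))
      have hat : a ≤ t := (le_max_left a r).trans (h.trans (min_le_right _ _))
      rw [min_eq_right hrb, min_eq_left hat]
      rcases le_total a r with h' | h'
      · rw [max_eq_right h', min_eq_left h']; ring
      · rw [max_eq_left h', min_eq_right h']; ring
  have hadapt : StronglyMeasurable[𝓕 r] fun ω => ξ ω * (W (min b r) ω - W (min a r) ω) := by
    rcases le_total a r with h | h
    · exact (hξ.mono (𝓕.mono h)).mul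
        (((hW.stronglyMeasurable _).mono (𝓕.mono (min_le_right _ _))).sub
          ((hW.stronglyMeasurable _).mono (𝓕.mono (min_le_right _ _))))
    · rw [min_eq_right h, min_eq_right (h.trans hab)]
      simpa using stronglyMeasurable_const
  rw [hdec]
  refine (condExp_add ((hmem _ _).integrable one_le_two) ((hmem _ _).integrable one_le_two) _).trans
    ?_
  rw [condExp_of_stronglyMeasurable (𝓕.le r) hadapt ((hmem _ _).integrable one_le_two)]
  have hz := hW.condExp_mul_sub (r := r) (le_max_right a r) (le_max_left (max a r) (min b t))
    (hξ.mono (𝓕.mono (le_max_left a r))) hC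
  filter_upwards [hz] with ω hω
  rw [Pi.add_apply, hω]
  simp

theorem SimplePredictable.isL2Martingale_integral (hW : HasCenteredIndepIncrements W 𝓕 P)
    (H : SimplePredictable 𝓕) : IsL2Martingale 𝓕 P (H.integral W) :=
  .sum fun i _ => hW.isL2Martingale_interval (H.t_mono i.le_succ) (H.ξ_meas i) (H.ξ_bdd i)

theorem IsItoIntegral.isL2Martingale (hW : HasCenteredIndepIncrements W 𝓕 P)
    {g N : ℝ≥0 → Ω → ℝ} (h : IsItoIntegral P 𝓕 W g N) (hN : ∀ t, AEStronglyMeasurable (N t) P) :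
    IsL2Martingale 𝓕 P N := by
  obtain ⟨H, hH⟩ := h
  exact .of_tendsto (fun k => (H k).isL2Martingale_integral hW) hN fun t => (hH t).2

omit [IsProbabilityMeasure P] in
theorem IsItoIntegral.ae_eq_zero {g N : ℝ≥0 → Ω → ℝ} (h : IsItoIntegral P 𝓕 W g N)
    (hN : AEStronglyMeasurable (N 0) P) : ∀ᵐ ω ∂P, N 0 ω = 0 := by
  obtain ⟨H, hH⟩ := h
  have h0 : ∀ k ω, (H k).integral W 0 ω = 0 := fun k ω => by
    simp [SimplePredictable.integral]
  have h1 := (hH 0).2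
  simp only [h0, zero_sub] at h1
  have h2 := tendsto_nhds_unique tendsto_const_nhds h1
  rw [eLpNorm_eq_zero_iff (f := fun ω => -N 0 ω) hN.neg two_ne_zero] at h2
  filter_upwards [h2] with ω hω
  simpa using hω

end Elementary

/-! ### Algebra of simple predictable processes -/

/-- Writes the value of a simple process as a sum of `ξ * (G b - G a)` with `G u = 1{s ≤ u}`, the
same shape as its integral with `G u = W (min u T)`. One identity for arbitrary `G` then serves
both. -/
theorem indicator_Ioc_eq_mul_sub {a b : ℝ≥0} (hab : a ≤ b) (x : ℝ) (s : ℝ≥0) :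
    (Set.Ioc a b).indicator (fun _ => x) s =
      x * ((if s ≤ b then (1 : ℝ) else 0) - if s ≤ a then 1 else 0) := by
  by_cases h1 : s ≤ a
  · have h2 : s ∉ Set.Ioc a b := fun h => absurd h.1 (not_lt.2 h1)
    simp [h1, h1.trans hab, h2]
  · by_cases h3 : s ≤ b
    · have h2 : s ∈ Set.Ioc a b := ⟨not_le.1 h1, h3⟩
      simp [h1, h3, h2]
    · have h2 : s ∉ Set.Ioc a b := fun h => h3 h.2
      simp [h1, h3, h2]

section Family

variable {Ω : Type*} {m : MeasurableSpace Ω} {𝓕 : Filtration ℝ≥0 m}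

theorem exists_monotone_enumeration (T : Finset ℝ≥0) :
    ∃ u : ℕ → ℝ≥0, Monotone u ∧ (∀ i j, i < j → j < T.card → u i < u j) ∧
      ∀ x ∈ T, ∃ i < T.card, u i = x := by
  rcases T.eq_empty_or_nonempty with rfl | hT
  · exact ⟨fun _ => 0, monotone_const, fun i j _ h => by simp at h, fun x h => by simp at h⟩
  have hpos : 0 < T.card := hT.card_pos
  let e := T.orderEmbOfFin rfl
  -- The enumeration is constant after its last point, because grids are indexed by all of `ℕ`.
  refine ⟨fun j => e ⟨min j (T.card - 1), by omega⟩, ?_, ?_, ?_⟩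
  · intro i j hij
    refine e.monotone ?_
    simp only [Fin.mk_le_mk]
    omega
  · intro i j hij hj
    refine e.strictMono ?_
    simp only [Fin.mk_lt_mk]
    omega
  · intro x hx
    have : x ∈ Set.range e := by rw [Finset.range_orderEmbOfFin]; exact hx
    obtain ⟨i, rfl⟩ := this
    exact ⟨i, i.2, congrArg e (Fin.ext (min_eq_left (Nat.le_sub_one_of_lt i.2)))⟩

/-- A finite family of interval processes can be written on a common grid. -/
theorem SimplePredictable.exists_of_intervals {ι : Type*} (S : Finset ι) (a b : ι → ℝ≥0)
    (hab : ∀ i, a i ≤ b i) (ξ : ι → Ω → ℝ) (hξ : ∀ i, StronglyMeasurable[𝓕 (a i)] (ξ i))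
    (hb : ∀ i, ∃ C : ℝ, ∀ ω, |ξ i ω| ≤ C) :
    ∃ H : SimplePredictable 𝓕, ∀ (G : ℝ≥0 → ℝ) ω,
      ∑ j ∈ Finset.range H.n, H.ξ j ω * (G (H.t (j + 1)) - G (H.t j)) =
        ∑ i ∈ S, ξ i ω * (G (b i) - G (a i)) := by
  classical
  obtain ⟨u, hu, hlt, hmem⟩ := exists_monotone_enumeration (S.image a ∪ S.image b)
  set k := (S.image a ∪ S.image b).card
  choose C hC using hb
  -- On a grid cell the coefficient is the sum over the intervals that contain the cell. Each term
  -- is known at the left end of the cell.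
  refine ⟨⟨k, u, hu, fun j ω => ∑ i ∈ S, if a i ≤ u j ∧ u (j + 1) ≤ b i then ξ i ω else 0,
    fun j => ?_, fun j => ⟨∑ i ∈ S, |C i|, fun ω => ?_⟩⟩, fun G ω => ?_⟩
  · refine Finset.stronglyMeasurable_fun_sum _ fun i _ => ?_
    by_cases h : a i ≤ u j ∧ u (j + 1) ≤ b i
    · simpa only [h, and_self, if_true] using (hξ i).mono (𝓕.mono h.1)
    · simpa only [h, if_false] using stronglyMeasurable_const
  · refine (Finset.abs_sum_le_sum_abs _ _).trans (Finset.sum_le_sum fun i _ => ?_)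
    split_ifs
    · exact (hC i ω).trans (le_abs_self _)
    · simp
  · simp only [Finset.sum_mul]
    rw [Finset.sum_comm]
    refine Finset.sum_congr rfl fun i hi => ?_
    obtain ⟨p, hpk, hp⟩ := hmem (a i)
      (Finset.mem_union_left _ (Finset.mem_image_of_mem a hi))
    obtain ⟨q, hqk, hq⟩ := hmem (b i)
      (Finset.mem_union_right _ (Finset.mem_image_of_mem b hi))
    have hpq : p ≤ q := by
      by_contra! h
      have := hlt q p h hpk
      rw [hp, hq] at this
      exact absurd this (not_lt.2 (hab i))
    have hterm : ∀ j ∈ Finset.range k,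
        (if a i ≤ u j ∧ u (j + 1) ≤ b i then ξ i ω else 0) * (G (u (j + 1)) - G (u j)) =
          if j ∈ Finset.Ico p q then ξ i ω * (G (u (j + 1)) - G (u j)) else 0 := by
      intro j hj
      rw [Finset.mem_range] at hj
      by_cases hin : j ∈ Finset.Ico p q
      · have h := Finset.mem_Ico.1 hin
        have h' : a i ≤ u j ∧ u (j + 1) ≤ b i := ⟨hp ▸ hu h.1, hq ▸ hu h.2⟩
        rw [if_pos hin, if_pos h']
      · rw [if_neg hin]
        split_ifs with h'
        · rw [Finset.mem_Ico, not_and_or, not_le, not_lt] at hin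
          rcases hin with hin | hin
          · exact absurd (hp ▸ h'.1) (not_le.2 (hlt j p hin hpk))
          -- A cell counted beyond `b i` has zero length (the constant tail of the grid) and
          -- contributes nothing.
          · have : u (j + 1) = u j :=
              le_antisymm (h'.2.trans (hq ▸ hu hin)) (hu j.le_succ)
            rw [this, sub_self, mul_zero]
        · rw [zero_mul]
    rw [Finset.sum_congr rfl hterm, Finset.sum_ite_mem,
      Finset.inter_eq_right.2 (fun j hj => Finset.mem_range.2
        ((Finset.mem_Ico.1 hj).2.trans hqk)), ← Finset.mul_sum,
      Finset.sum_Ico_sub (fun j => G (u j)) hpq, hp, hq]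

end Family

/-- The process `v` is simple predictable, with elementary integral process `I`. -/
def IsElementary {Ω : Type*} {m : MeasurableSpace Ω} (𝓕 : Filtration ℝ≥0 m) (W v I : ℝ≥0 → Ω → ℝ) :
    Prop :=
  ∃ H : SimplePredictable 𝓕, H.val = v ∧ H.integral W = I

namespace IsElementary

variable {Ω : Type*} {m : MeasurableSpace Ω} {𝓕 : Filtration ℝ≥0 m} {W v I v' I' : ℝ≥0 → Ω → ℝ}

theorem zero : IsElementary 𝓕 W (fun _ _ => 0) fun _ _ => 0 := by
  refine ⟨⟨0, fun _ => 0, monotone_const, fun _ _ => 0, fun _ => stronglyMeasurable_const,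
    fun _ => ⟨0, fun _ => by simp⟩⟩, ?_, ?_⟩ <;>
  · funext s ω
    simp [SimplePredictable.val, SimplePredictable.integral]

theorem add (h : IsElementary 𝓕 W v I) (h' : IsElementary 𝓕 W v' I') :
    IsElementary 𝓕 W (fun s ω => v s ω + v' s ω) fun T ω => I T ω + I' T ω := by
  obtain ⟨H, rfl, rfl⟩ := h
  obtain ⟨H', rfl, rfl⟩ := h'
  obtain ⟨K, hK⟩ := SimplePredictable.exists_of_intervals (𝓕 := 𝓕)
    ((Finset.range H.n).disjSum (Finset.range H'.n)) (Sum.elim H.t H'.t)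
    (Sum.elim (fun i => H.t (i + 1)) fun i => H'.t (i + 1))
    (by rintro (i | i) <;> simp [H.t_mono i.le_succ, H'.t_mono i.le_succ])
    (Sum.elim H.ξ H'.ξ)
    (by rintro (i | i); exacts [H.ξ_meas i, H'.ξ_meas i])
    (by rintro (i | i); exacts [H.ξ_bdd i, H'.ξ_bdd i])
  simp only [Finset.sum_disjSum, Sum.elim_inl, Sum.elim_inr] at hK
  refine ⟨K, ?_, ?_⟩
  · funext s ω
    have h := hK (fun u => if s ≤ u then 1 else 0) ω
    simp only [← indicator_Ioc_eq_mul_sub (H.t_mono (Nat.le_succ _)),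
      ← indicator_Ioc_eq_mul_sub (H'.t_mono (Nat.le_succ _)),
      ← indicator_Ioc_eq_mul_sub (K.t_mono (Nat.le_succ _))] at h
    exact h
  · funext T ω
    exact hK (fun u => W (min u T) ω) ω

theorem neg (h : IsElementary 𝓕 W v I) :
    IsElementary 𝓕 W (fun s ω => -v s ω) fun T ω => -I T ω := by
  obtain ⟨H, rfl, rfl⟩ := h
  refine ⟨⟨H.n, H.t, H.t_mono, fun i ω => -H.ξ i ω, fun i => (H.ξ_meas i).neg,
    fun i => ?_⟩, ?_, ?_⟩
  · simpa only [abs_neg] using H.ξ_bdd i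
  · funext s ω
    simp only [SimplePredictable.val, ← Finset.sum_neg_distrib]
    refine Finset.sum_congr rfl fun i _ => ?_
    by_cases h : s ∈ Set.Ioc (H.t i) (H.t (i + 1)) <;> simp [h]
  · funext T ω
    simp only [SimplePredictable.integral, ← Finset.sum_neg_distrib, neg_mul]

theorem sub (h : IsElementary 𝓕 W v I) (h' : IsElementary 𝓕 W v' I') :
    IsElementary 𝓕 W (fun s ω => v s ω - v' s ω) fun T ω => I T ω - I' T ω := by
  simpa only [sub_eq_add_neg] using h.add h'.neg

theorem sum {ι : Type*} (S : Finset ι) {v I : ι → ℝ≥0 → Ω → ℝ}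
    (h : ∀ i, IsElementary 𝓕 W (v i) (I i)) :
    IsElementary 𝓕 W (fun s ω => ∑ i ∈ S, v i s ω) fun T ω => ∑ i ∈ S, I i T ω := by
  classical
  induction S using Finset.induction_on with
  | empty => simpa using zero
  | insert i S hi ih =>
    simp only [Finset.sum_insert hi]
    exact (h i).add ih

/-- Restricting a simple predictable process to the times after `r`, on an event known at `r`. -/
theorem restrict (h : IsElementary 𝓕 W v I) (r : ℝ≥0) {F : Set Ω} (hF : MeasurableSet[𝓕 r] F) :
    IsElementary 𝓕 W (fun s ω => F.indicator (fun ω => (Set.Ioi r).indicator (fun s => v s ω) s) ω)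
      fun T ω => F.indicator (fun ω => I T ω - I (min r T) ω) ω := by
  obtain ⟨H, rfl, rfl⟩ := h
  -- Pushing grid points up to `r` collapses the cells before `r` and makes the event `F` known at
  -- every left end.
  refine ⟨⟨H.n, fun i => max (H.t i) r, fun i j hij => max_le_max_right r (H.t_mono hij),
    fun i => F.indicator (H.ξ i), fun i => ?_, fun i => ?_⟩, ?_, ?_⟩
  · exact ((H.ξ_meas i).mono (𝓕.mono (le_max_left _ _))).indicator
      (𝓕.mono (le_max_right _ _) _ hF)
  · obtain ⟨C, hC⟩ := H.ξ_bdd i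
    refine ⟨|C|, fun ω => ?_⟩
    by_cases hω : ω ∈ F
    · simpa only [Set.indicator_of_mem hω] using (hC ω).trans (le_abs_self C)
    · simp [Set.indicator_of_notMem hω]
  · funext s ω
    by_cases hω : ω ∈ F
    · simp only [SimplePredictable.val, Set.indicator_of_mem hω]
      by_cases hs : s ∈ Set.Ioi r
      · rw [Set.indicator_of_mem hs]
        refine Finset.sum_congr rfl fun i _ => ?_
        have hs' : r < s := hs
        have : s ∈ Set.Ioc (max (H.t i) r) (max (H.t (i + 1)) r) ↔
            s ∈ Set.Ioc (H.t i) (H.t (i + 1)) := by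
          simp [Set.mem_Ioc, hs', not_le.2 hs']
        by_cases h : s ∈ Set.Ioc (H.t i) (H.t (i + 1))
        · rw [Set.indicator_of_mem h, Set.indicator_of_mem (this.2 h)]
        · rw [Set.indicator_of_notMem h, Set.indicator_of_notMem (fun h' => h (this.1 h'))]
      · rw [Set.indicator_of_notMem hs]
        refine Finset.sum_eq_zero fun i _ => Set.indicator_of_notMem (fun h => hs ?_) _
        exact (le_max_right _ _).trans_lt h.1
    · simp [SimplePredictable.val, Set.indicator_of_notMem hω]
  · funext T ω
    by_cases hω : ω ∈ F
    · simp only [SimplePredictable.integral, Set.indicator_of_mem hω, ← Finset.sum_sub_distrib,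
        ← mul_sub]
      have key : ∀ x : ℝ≥0, W (min (max x r) T) ω =
          W (min x T) ω - W (min x (min r T)) ω + W (min r T) ω := fun x => by
        rcases le_total x r with hx | hx
        · rw [max_eq_right hx, ← min_assoc, min_eq_left hx]; ring
        · rw [max_eq_left hx, ← min_assoc, min_eq_right hx]; ring
      refine Finset.sum_congr rfl fun i _ => ?_
      rw [key, key]
      ring
    · simp [SimplePredictable.integral, Set.indicator_of_notMem hω]

end IsElementary

/-! ### Second moments at countably-valued stopping times -/

section StoppedNorms

theorem eLpNorm_two_sq {α : Type*} {m : MeasurableSpace α} (μ : Measure α) (f : α → ℝ) :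
    eLpNorm f 2 μ ^ 2 = ∫⁻ x, ‖f x‖ₑ ^ 2 ∂μ := by
  simpa using eLpNorm_nnreal_pow_eq_lintegral (f := f) (μ := μ) (p := 2) two_ne_zero

variable {Ω : Type*} {m : MeasurableSpace Ω} {𝓕 : Filtration ℝ≥0 m} {P : Measure Ω}
  {M : ℝ≥0 → Ω → ℝ}

theorem measurableSet_of_fibers {k : Ω → ℕ} {r : ℕ → ℝ≥0} {F : Set Ω}
    (hF : ∀ j, MeasurableSet[𝓕 (r j)] (F ∩ {ω | k ω = j})) : MeasurableSet F := by
  have : F = ⋃ j, F ∩ {ω | k ω = j} := by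
    ext ω; simp
  rw [this]
  exact .iUnion fun j => 𝓕.le _ _ (hF j)

theorem lintegral_eq_tsum_fibers {k : Ω → ℕ} {F : Set Ω}
    (hF : ∀ j, MeasurableSet (F ∩ {ω | k ω = j})) (f : Ω → ℝ≥0∞) :
    ∫⁻ ω in F, f ω ∂P = ∑' j, ∫⁻ ω in F ∩ {ω | k ω = j}, f ω ∂P := by
  rw [← lintegral_iUnion hF]
  · congr 2
    ext ω; simp
  · intro i j hij
    refine Set.disjoint_left.2 fun ω h1 h2 => hij ?_
    rw [← h1.2, ← h2.2]

/-- Second moments at a countably-valued stopping time are dominated by those at a later time. -/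
theorem IsL2Martingale.lintegral_stopped_le [IsFiniteMeasure P] (hM : IsL2Martingale 𝓕 P M)
    {k : Ω → ℕ} {r : ℕ → ℝ≥0}
    {F : Set Ω} (hF : ∀ j, MeasurableSet[𝓕 (r j)] (F ∩ {ω | k ω = j})) (T : ℝ≥0) :
    ∫⁻ ω in F, ‖M (min (r (k ω)) T) ω‖ₑ ^ 2 ∂P ≤ ∫⁻ ω in F, ‖M T ω‖ₑ ^ 2 ∂P := by
  have hF' : ∀ j, MeasurableSet (F ∩ {ω | k ω = j}) := fun j => 𝓕.le _ _ (hF j)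
  rw [lintegral_eq_tsum_fibers hF', lintegral_eq_tsum_fibers hF']
  refine ENNReal.tsum_le_tsum fun j => ?_
  have he : ∫⁻ ω in F ∩ {ω | k ω = j}, ‖M (min (r (k ω)) T) ω‖ₑ ^ 2 ∂P =
      ∫⁻ ω in F ∩ {ω | k ω = j}, ‖M (min (r j) T) ω‖ₑ ^ 2 ∂P :=
    setLIntegral_congr_fun (hF' j) fun ω hω => by
      have : k ω = j := hω.2
      simp only [this]
  rw [he]
  rcases le_total (r j) T with h | h
  · rw [min_eq_left h, ← eLpNorm_two_sq, ← eLpNorm_two_sq]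
    gcongr
    exact hM.eLpNorm_restrict_le h (hF j)
  · rw [min_eq_right h]

theorem IsL2Martingale.eLpNorm_stopped_le [IsFiniteMeasure P] (hM : IsL2Martingale 𝓕 P M)
    {k : Ω → ℕ} {r : ℕ → ℝ≥0}
    {F : Set Ω} (hF : ∀ j, MeasurableSet[𝓕 (r j)] (F ∩ {ω | k ω = j})) (T : ℝ≥0) :
    eLpNorm (fun ω => M (min (r (k ω)) T) ω) 2 (P.restrict F) ≤ eLpNorm (M T) 2 P := by
  have h := hM.lintegral_stopped_le hF T
  rw [← eLpNorm_two_sq, ← eLpNorm_two_sq (P.restrict F) (M T)] at h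
  exact ((ENNReal.pow_le_pow_left_iff two_ne_zero).1 h).trans
    (eLpNorm_mono_measure _ Measure.restrict_le_self)

/-- If the values of a martingale at countably-valued stopping times tend to zero almost surely on
an event, then they do so in mean square. -/
theorem IsL2Martingale.tendsto_eLpNorm_stopped [IsProbabilityMeasure P]
    (hM : IsL2Martingale 𝓕 P M) (hadapt : ∀ t, Measurable[𝓕 t] (M t)) {k : ℕ → Ω → ℕ}
      {r : ℕ → ℕ → ℝ≥0} {F : Set Ω}
    (hF : ∀ i j, MeasurableSet[𝓕 (r i j)] (F ∩ {ω | k i ω = j})) (T : ℝ≥0)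
    (hlim : ∀ᵐ ω ∂P, ω ∈ F →
      Filter.Tendsto (fun i => M (min (r i (k i ω)) T) ω) Filter.atTop (nhds 0)) :
    Filter.Tendsto (fun i => eLpNorm (fun ω => M (min (r i (k i ω)) T) ω) 2 (P.restrict F))
      Filter.atTop (nhds 0) := by
  have hFm : MeasurableSet F := measurableSet_of_fibers (hF 0)
  have hsq : Filter.Tendsto (fun i => ∫⁻ ω in F, ‖M (min (r i (k i ω)) T) ω‖ₑ ^ 2 ∂P)
      Filter.atTop (nhds 0) := by
    rw [ENNReal.tendsto_nhds_zero]
    intro ε hε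
    set δ : ℝ≥0∞ := min 1 (ε / 2)
    have hδ0 : 0 < δ := lt_min one_pos (ENNReal.half_pos hε.ne')
    have hδ : δ ^ 2 ≤ ε / 2 := by
      calc δ ^ 2 = δ * δ := sq δ
        _ ≤ 1 * (ε / 2) := mul_le_mul' (min_le_left _ _) (min_le_right _ _)
        _ = ε / 2 := one_mul _
    -- Each `G i` is known at the stopping time, so the second moment there is at most that of the
    -- fixed variable `M T` on `G i`. The latter vanishes because `P (G i)` tends to 0. Off `G i`
    -- the integrand is at most `δ ^ 2`, so no maximal inequality is needed.
    let G : ℕ → Set Ω := fun i => F ∩ {ω | δ < ‖M (min (r i (k i ω)) T) ω‖ₑ}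
    have hG : ∀ i j, MeasurableSet[𝓕 (r i j)] (G i ∩ {ω | k i ω = j}) := by
      intro i j
      have he : G i ∩ {ω | k i ω = j} =
          (F ∩ {ω | k i ω = j}) ∩ {ω | δ < ‖M (min (r i j) T) ω‖ₑ} := by
        ext ω
        simp only [G, Set.mem_inter_iff, Set.mem_ofPred_eq]
        constructor
        · rintro ⟨⟨h1, h2⟩, rfl⟩; exact ⟨⟨h1, rfl⟩, h2⟩
        · rintro ⟨⟨h1, rfl⟩, h2⟩; exact ⟨⟨h1, h2⟩, rfl⟩
      rw [he]
      refine (hF i j).inter ?_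
      have hm : Measurable[𝓕 (r i j)] (M (min (r i j) T)) :=
        (hadapt _).mono (𝓕.mono (min_le_left _ _)) le_rfl
      exact (measurable_enorm.comp hm) measurableSet_Ioi
    have hGm : ∀ i, MeasurableSet (G i) := fun i => measurableSet_of_fibers (hG i)
    have hPG : Filter.Tendsto (P ∘ G) Filter.atTop (nhds 0) := by
      rw [← measure_empty (μ := P)]
      refine tendsto_measure_of_ae_tendsto_indicator_of_isFiniteMeasure _ .empty hGm ?_
      filter_upwards [hlim] with ω hω
      by_cases hωF : ω ∈ F
      · have h := (hω hωF).enorm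
        rw [enorm_zero] at h
        filter_upwards [h.eventually (gt_mem_nhds hδ0)] with i hi
        exact iff_of_false (fun h' => lt_asymm hi h'.2) id
      · exact .of_forall fun i => iff_of_false (fun h' => hωF h'.1) id
    have hfin : ∫⁻ ω, ‖M T ω‖ₑ ^ 2 ∂P ≠ ∞ := by
      rw [← eLpNorm_two_sq]
      exact ENNReal.pow_ne_top (hM.memLp T).2.ne
    have hb := tendsto_setLIntegral_zero hfin hPG
    rw [ENNReal.tendsto_nhds_zero] at hb
    filter_upwards [hb (ε / 2) (ENNReal.half_pos hε.ne')] with i hi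
    rw [← lintegral_inter_add_sdiff (μ := P) _ F (hGm i), ← ENNReal.add_halves ε]
    have hFG : F ∩ G i = G i := Set.inter_eq_right.2 Set.inter_subset_left
    rw [hFG]
    refine add_le_add ((hM.lintegral_stopped_le (hG i) T).trans hi) (le_trans ?_ hδ)
    calc _ ≤ ∫⁻ _ in F \ G i, δ ^ 2 ∂P := by
          refine setLIntegral_mono' (hFm.diff (hGm i)) fun ω hω => ?_
          gcongr
          by_contra! h
          exact hω.2 ⟨hω.1, h⟩
      _ = δ ^ 2 * P (F \ G i) := by rw [setLIntegral_const]
      _ ≤ δ ^ 2 * 1 := by gcongr; exact prob_le_one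
      _ = δ ^ 2 := mul_one _
  have h2 := (ENNReal.continuous_rpow_const (y := 1 / 2)).tendsto 0 |>.comp hsq
  rw [ENNReal.zero_rpow_of_pos (by norm_num)] at h2
  refine h2.congr fun i => ?_
  rw [Function.comp, ← eLpNorm_two_sq, ← ENNReal.rpow_natCast, ← ENNReal.rpow_mul]
  norm_num

end StoppedNorms

/-! ### Rounding a random time up to a grid -/

section Grid

/-- The `j`-th point of the grid with mesh `1 / (m + 1)`. -/
def gridTime (m j : ℕ) : ℝ≥0 := j / (m + 1)

/-- The index of the first grid point after `x`. -/
def gridIndex (m : ℕ) (x : ℝ≥0) : ℕ := ⌈x * (m + 1)⌉₊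

theorem gridIndex_le_iff {m i : ℕ} {x : ℝ≥0} : gridIndex m x ≤ i ↔ x ≤ gridTime m i := by
  rw [gridIndex, gridTime, Nat.ceil_le, le_div_iff₀ (by positivity)]

theorem le_gridTime_gridIndex (m : ℕ) (x : ℝ≥0) : x ≤ gridTime m (gridIndex m x) :=
  gridIndex_le_iff.1 le_rfl

theorem gridTime_gridIndex_le (m : ℕ) (x : ℝ≥0) :
    gridTime m (gridIndex m x) ≤ x + 1 / ((m : ℝ≥0) + 1) := by
  have h : ((gridIndex m x : ℕ) : ℝ≥0) ≤ x * (m + 1) + 1 :=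
    (Nat.ceil_lt_add_one (zero_le (a := x * (m + 1)))).le
  rw [gridTime, div_le_iff₀ (by positivity), add_mul, one_div, inv_mul_cancel₀ (by positivity)]
  exact h

theorem tendsto_gridTime_gridIndex (x : ℝ≥0) :
    Filter.Tendsto (fun m => gridTime m (gridIndex m x)) Filter.atTop (nhds x) := by
  refine tendsto_of_tendsto_of_tendsto_of_le_of_le tendsto_const_nhds ?_
    (fun m => le_gridTime_gridIndex m x) (fun m => gridTime_gridIndex_le m x)
  simpa using (tendsto_const_nhds (x := x)).add
    (tendsto_one_div_add_atTop_nhds_zero_nat (𝕜 := ℝ≥0))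

/-- The first `(m + 1) ^ 2` grid points cover `[0, m]`, so a finite sum over grid indices is enough
for times up to `m`. -/
theorem le_gridTime_of_le {m j : ℕ} (h : (m + 1) ^ 2 ≤ j) : (m : ℝ≥0) ≤ gridTime m j := by
  rw [gridTime, le_div_iff₀ (by positivity)]
  have h1 : (((m + 1) ^ 2 : ℕ) : ℝ≥0) ≤ j := by exact_mod_cast h
  refine le_trans ?_ h1
  push_cast
  rw [sq]
  gcongr
  simp

theorem sum_fiber_indicator {Ω : Type*} (A : Set Ω) [DecidablePred (· ∈ A)] (k : Ω → ℕ) (J : ℕ)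
    (f : ℕ → Ω → ℝ) (ω : Ω) :
    ∑ j ∈ Finset.range J, (A ∩ {ω | k ω = j}).indicator (f j) ω =
      if ω ∈ A ∧ k ω < J then f (k ω) ω else 0 := by
  split_ifs with h
  · rw [Finset.sum_eq_single_of_mem (k ω) (Finset.mem_range.2 h.2)]
    · rw [Set.indicator_of_mem]
      exact ⟨h.1, rfl⟩
    · intro j _ hj
      exact Set.indicator_of_notMem (fun h' => hj h'.2.symm) _
  · refine Finset.sum_eq_zero fun j hj => Set.indicator_of_notMem (fun h' => h ?_) _
    have h2 : k ω = j := h'.2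
    exact ⟨h'.1, h2 ▸ Finset.mem_range.1 hj⟩

end Grid

/-! ### Pasting integrands -/

section Paste

variable {Ω : Type*} {m₀ : MeasurableSpace Ω} {𝓕 : Filtration ℝ≥0 m₀} {P : Measure Ω}
  {W g g' N N' : ℝ≥0 → Ω → ℝ}

theorem IsItoIntegral.congr (h : IsItoIntegral P 𝓕 W g N) (hN : ∀ t, N t =ᵐ[P] N' t) :
    IsItoIntegral P 𝓕 W g N' := by
  obtain ⟨H, hH⟩ := h
  refine ⟨H, fun T => ⟨(hH T).1, (hH T).2.congr fun k => eLpNorm_congr_ae ?_⟩⟩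
  filter_upwards [hN T] with ω hω
  rw [hω]

/-- Rounding up keeps a stopping time: fibre `j` is `{z ≤ gridTime m j}` minus the earlier such
events. Everything is cut down to `A`, since `z` is a stopping time only there. -/
theorem measurableSet_gridIndex_fiber {A : Set Ω} {z : Ω → ℝ≥0}
    (hA : ∀ t, MeasurableSet[𝓕 t] (A ∩ {ω | z ω ≤ t})) (m j : ℕ) :
    MeasurableSet[𝓕 (gridTime m j)] (A ∩ {ω | gridIndex m (z ω) = j}) := by
  have he : A ∩ {ω | gridIndex m (z ω) = j} = (A ∩ {ω | z ω ≤ gridTime m j}) \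
      ⋃ i ∈ Finset.range j, A ∩ {ω | z ω ≤ gridTime m i} := by
    ext ω
    simp only [← gridIndex_le_iff, Set.mem_inter_iff, Set.mem_ofPred_eq, Set.mem_sdiff,
      Set.mem_iUnion, Finset.mem_range, exists_prop, not_exists, not_and]
    constructor
    · rintro ⟨h1, rfl⟩
      exact ⟨⟨h1, le_rfl⟩, fun i hi _ => not_le.2 hi⟩
    · rintro ⟨⟨h1, h2⟩, h3⟩
      refine ⟨h1, le_antisymm h2 ?_⟩
      by_contra! h
      exact h3 _ h h1 le_rfl
  rw [he]
  refine (hA _).diff (Finset.measurableSet_biUnion _ fun i hi => ?_)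
  refine 𝓕.mono ?_ _ (hA (gridTime m i))
  rw [Finset.mem_range] at hi
  unfold gridTime
  gcongr

theorem SimplePredictable.measurable_val (H : SimplePredictable 𝓕) :
    Measurable (Function.uncurry H.val) := by
  change Measurable fun x : ℝ≥0 × Ω => ∑ i ∈ Finset.range H.n,
    (Set.Ioc (H.t i) (H.t (i + 1))).indicator (fun _ => H.ξ i x.2) x.1
  refine Finset.measurable_fun_sum _ fun i _ => ?_
  have he : (fun x : ℝ≥0 × Ω => (Set.Ioc (H.t i) (H.t (i + 1))).indicator
      (fun _ => H.ξ i x.2) x.1) = (Set.Ioc (H.t i) (H.t (i + 1)) ×ˢ Set.univ).indicator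
        (fun x : ℝ≥0 × Ω => H.ξ i x.2) := by
    funext x
    by_cases h : x.1 ∈ Set.Ioc (H.t i) (H.t (i + 1)) <;> simp [h, Set.indicator]
  rw [he]
  exact ((((H.ξ_meas i).mono (𝓕.le _)).measurable).comp measurable_snd).indicator
    (measurableSet_Ioc.prod .univ)

theorem lintegral_two_mul_add {α : Type*} {mα : MeasurableSpace α} {μ : Measure α}
    {a b : α → ℝ≥0∞} (ha : Measurable a) (hb : Measurable b) (c : α → ℝ≥0∞) :
    ∫⁻ x, (2 * a x + 2 * b x + c x) ∂μ = 2 * ∫⁻ x, a x ∂μ + 2 * ∫⁻ x, b x ∂μ + ∫⁻ x, c x ∂μ := by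
  rw [lintegral_add_left (f := fun x => 2 * a x + 2 * b x)
      ((ha.const_mul 2).add (hb.const_mul 2)), lintegral_add_left (ha.const_mul 2),
        lintegral_const_mul _ ha, lintegral_const_mul _ hb]

/-- The squared distance between two processes in `L²([0, T] × Ω)`. -/
def sqDist (P : Measure Ω) (T : ℝ≥0) (u v : ℝ≥0 → Ω → ℝ) : ℝ≥0∞ :=
  ∫⁻ ω, (∫⁻ s in Set.Ioc (0 : ℝ) T,
    ENNReal.ofReal ((u s.toNNReal ω - v s.toNNReal ω) ^ 2)) ∂P

theorem sq_sub_le_two_mul (x y w : ℝ) :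
    ENNReal.ofReal ((x - y) ^ 2) ≤
      2 * ENNReal.ofReal ((x - w) ^ 2) + 2 * ENNReal.ofReal ((w - y) ^ 2) := by
  rw [← ENNReal.ofReal_ofNat, ← ENNReal.ofReal_mul zero_le_two, ← ENNReal.ofReal_mul zero_le_two,
    ← ENNReal.ofReal_add (by positivity) (by positivity)]
  refine ENNReal.ofReal_le_ofReal ?_
  nlinarith [sq_nonneg ((x - w) - (w - y))]

-- Here `w` switches at the rounded time `ρ` and the target at `z`. Outside the window `(z, ρ]` the
-- error is that of one of the two approximations. Inside it the additional discrepancy is `g' - g`,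
-- at most `2 * C` in size, over a length of at most `δ`.
open Classical in
theorem sqDist_paste_le {v v' w : ℝ≥0 → Ω → ℝ} [IsProbabilityMeasure P]
    (hg : Measurable (Function.uncurry g)) (hg' : Measurable (Function.uncurry g'))
    (hv : Measurable (Function.uncurry v)) (hv' : Measurable (Function.uncurry v'))
    {C : ℝ} (hC : ∀ᵐ ω ∂P, ∀ t, |g t ω| ≤ C) (hC' : ∀ᵐ ω ∂P, ∀ t, |g' t ω| ≤ C)
    {A : Set Ω} {z ρ : Ω → ℝ≥0} {δ : ℝ≥0} (hzρ : ∀ ω, z ω ≤ ρ ω) (hρ : ∀ ω, ρ ω ≤ z ω + δ)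
    {T : ℝ≥0} (hw : ∀ s ≤ T, ∀ ω, w s ω = if ω ∈ A ∧ ρ ω < s then v' s ω else v s ω) :
    sqDist P T w (fun t ω => if ω ∈ A ∧ z ω < t then g' t ω else g t ω) ≤
      2 * sqDist P T v g + 2 * sqDist P T v' g' +
        2 * ENNReal.ofReal ((2 * C) ^ 2) * δ := by
  have hmeas : ∀ {u f : ℝ≥0 → Ω → ℝ}, Measurable (Function.uncurry u) →
      Measurable (Function.uncurry f) →
      Measurable fun x : Ω × ℝ => ENNReal.ofReal ((u x.2.toNNReal x.1 - f x.2.toNNReal x.1) ^ 2) :=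
        by
    intro u f hu hf
    have hp : Measurable fun x : Ω × ℝ => (x.2.toNNReal, x.1) :=
      measurable_snd.real_toNNReal.prodMk measurable_fst
    exact (((hu.comp hp).sub (hf.comp hp)).pow_const 2).ennreal_ofReal
  have hmeas' : ∀ {u f : ℝ≥0 → Ω → ℝ}, Measurable (Function.uncurry u) →
      Measurable (Function.uncurry f) → ∀ ω,
      Measurable fun s : ℝ => ENNReal.ofReal ((u s.toNNReal ω - f s.toNNReal ω) ^ 2) := by
    intro u f hu hf ω
    have hp : Measurable fun s : ℝ => (s.toNNReal, ω) :=
      measurable_real_toNNReal.prodMk measurable_const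
    exact (((hu.comp hp).sub (hf.comp hp)).pow_const 2).ennreal_ofReal
  have hm1 := hmeas hv hg
  have hm2 := hmeas hv' hg'
  have hinner : ∀ᵐ ω ∂P, (∫⁻ s in Set.Ioc (0 : ℝ) T, ENNReal.ofReal ((w s.toNNReal ω -
      (if ω ∈ A ∧ z ω < s.toNNReal then g' s.toNNReal ω else g s.toNNReal ω)) ^ 2)) ≤
      2 * (∫⁻ s in Set.Ioc (0 : ℝ) T,
        ENNReal.ofReal ((v s.toNNReal ω - g s.toNNReal ω) ^ 2)) +
      2 * (∫⁻ s in Set.Ioc (0 : ℝ) T,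
        ENNReal.ofReal ((v' s.toNNReal ω - g' s.toNNReal ω) ^ 2)) +
      2 * ENNReal.ofReal ((2 * C) ^ 2) * δ := by
    filter_upwards [hC, hC'] with ω h h'
    have hpt : ∀ s ∈ Set.Ioc (0 : ℝ) T, ENNReal.ofReal ((w s.toNNReal ω -
        (if ω ∈ A ∧ z ω < s.toNNReal then g' s.toNNReal ω else g s.toNNReal ω)) ^ 2) ≤
        2 * ENNReal.ofReal ((v s.toNNReal ω - g s.toNNReal ω) ^ 2) +
        2 * ENNReal.ofReal ((v' s.toNNReal ω - g' s.toNNReal ω) ^ 2) +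
        (Set.Ioc (z ω : ℝ) (ρ ω)).indicator
          (fun _ => 2 * ENNReal.ofReal ((2 * C) ^ 2)) s := by
      rintro s ⟨hs0, hsT⟩
      rw [hw _ (Real.toNNReal_le_iff_le_coe.2 hsT)]
      set t := s.toNNReal with ht
      have hst : s = t := (Real.coe_toNNReal s hs0.le).symm
      by_cases h1 : ω ∈ A ∧ ρ ω < t
      · rw [if_pos h1, if_pos ⟨h1.1, (hzρ ω).trans_lt h1.2⟩]
        calc _ = 1 * ENNReal.ofReal ((v' t ω - g' t ω) ^ 2) := (one_mul _).symm
          _ ≤ 2 * ENNReal.ofReal ((v' t ω - g' t ω) ^ 2) := by gcongr; exact one_le_two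
          _ ≤ _ := le_add_right le_add_self
      · rw [if_neg h1]
        by_cases h2 : ω ∈ A ∧ z ω < t
        · rw [if_pos h2]
          have hmem : s ∈ Set.Ioc (z ω : ℝ) (ρ ω) := by
            rw [hst]
            exact ⟨NNReal.coe_lt_coe.2 h2.2,
              NNReal.coe_le_coe.2 (not_lt.1 fun h3 => h1 ⟨h2.1, h3⟩)⟩
          rw [Set.indicator_of_mem hmem]
          refine (sq_sub_le_two_mul _ _ (g t ω)).trans ?_
          refine add_le_add le_self_add ?_
          gcongr 2 * ENNReal.ofReal ?_
          refine sq_le_sq.2 ((abs_sub _ _).trans ?_)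
          refine le_trans ?_ (le_abs_self _)
          linarith [h t, h' t]
        · rw [if_neg h2]
          calc _ = 1 * ENNReal.ofReal ((v t ω - g t ω) ^ 2) := (one_mul _).symm
            _ ≤ 2 * ENNReal.ofReal ((v t ω - g t ω) ^ 2) := by gcongr; exact one_le_two
            _ ≤ _ := (le_self_add).trans le_self_add
    refine (setLIntegral_mono' measurableSet_Ioc hpt).trans ?_
    refine (lintegral_two_mul_add (hmeas' hv hg ω) (hmeas' hv' hg' ω) _).trans_le
      (add_le_add le_rfl ?_)
    rw [lintegral_indicator_const measurableSet_Ioc]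
    gcongr
    refine (Measure.restrict_apply_le _ _).trans ?_
    rw [Real.volume_Ioc]
    have : ((ρ ω : ℝ) - z ω) ≤ δ := by
      have := NNReal.coe_le_coe.2 (hρ ω)
      push_cast at this
      linarith
    exact (ENNReal.ofReal_le_ofReal this).trans_eq (ENNReal.ofReal_coe_nnreal)
  refine (lintegral_mono_ae hinner).trans ?_
  have ho1 := hm1.lintegral_prod_right' (ν := volume.restrict (Set.Ioc (0 : ℝ) T))
  have ho2 := hm2.lintegral_prod_right' (ν := volume.restrict (Set.Ioc (0 : ℝ) T))
  refine (lintegral_two_mul_add ho1 ho2 _).trans_le (add_le_add le_rfl ?_)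
  rw [lintegral_const, measure_univ, mul_one]

end Paste

/-! ### Pasting Itô integrals -/

section PasteIntegral

variable {Ω : Type*} {m₀ : MeasurableSpace Ω} {𝓕 : Filtration ℝ≥0 m₀} {P : Measure Ω}
  [IsProbabilityMeasure P] {W g g' N N' : ℝ≥0 → Ω → ℝ}

open Classical in
/-- Pasting two simple predictable processes along the grid approximation of a random time. -/
theorem SimplePredictable.exists_paste (H H' : SimplePredictable 𝓕) {A : Set Ω} {z : Ω → ℝ≥0}
    (hA : ∀ t, MeasurableSet[𝓕 t] (A ∩ {ω | z ω ≤ t})) (m : ℕ) :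
    ∃ K : SimplePredictable 𝓕,
      (∀ s ≤ (m : ℝ≥0), ∀ ω, K.val s ω =
        if ω ∈ A ∧ gridTime m (gridIndex m (z ω)) < s then H'.val s ω else H.val s ω) ∧
      ∀ T ≤ (m : ℝ≥0), ∀ ω, K.integral W T ω = H.integral W T ω + A.indicator
        (fun ω => (H'.integral W T ω - H.integral W T ω) -
          (H'.integral W (min (gridTime m (gridIndex m (z ω))) T) ω -
            H.integral W (min (gridTime m (gridIndex m (z ω))) T) ω)) ω := by
  have hd : IsElementary 𝓕 W (fun s ω => H'.val s ω - H.val s ω)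
      fun T ω => H'.integral W T ω - H.integral W T ω :=
    IsElementary.sub ⟨H', rfl, rfl⟩ ⟨H, rfl, rfl⟩
  -- On fibre `j` the difference `H' - H` is switched on after `gridTime m j`. Fibres left out of
  -- the finite sum would switch only after time `m`, so the formulas hold up to `m`.
  obtain ⟨K, hKv, hKI⟩ := IsElementary.add ⟨H, rfl, rfl⟩
    (IsElementary.sum (Finset.range ((m + 1) ^ 2)) fun j =>
      hd.restrict (gridTime m j) (measurableSet_gridIndex_fiber hA m j))
  refine ⟨K, fun s hs ω => ?_, fun T hT ω => ?_⟩
  · have h1 := congrFun (congrFun hKv s) ω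
    rw [h1, sum_fiber_indicator A (fun ω => gridIndex m (z ω)) ((m + 1) ^ 2)
      (fun j ω => (Set.Ioi (gridTime m j)).indicator (fun s => H'.val s ω - H.val s ω) s)]
    by_cases h2 : ω ∈ A ∧ gridTime m (gridIndex m (z ω)) < s
    · have h3 : gridIndex m (z ω) < (m + 1) ^ 2 := by
        by_contra! h
        exact absurd (h2.2.trans_le hs) (not_lt.2 (le_gridTime_of_le h))
      have h4 : s ∈ Set.Ioi (gridTime m (gridIndex m (z ω))) := h2.2
      rw [if_pos h2, if_pos ⟨h2.1, h3⟩, Set.indicator_of_mem h4]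
      ring
    · rw [if_neg h2]
      split_ifs with h3
      · have h4 : s ∉ Set.Ioi (gridTime m (gridIndex m (z ω))) := fun h => h2 ⟨h3.1, h⟩
        rw [Set.indicator_of_notMem h4, add_zero]
      · rw [add_zero]
  · have h1 := congrFun (congrFun hKI T) ω
    rw [h1, sum_fiber_indicator A (fun ω => gridIndex m (z ω)) ((m + 1) ^ 2)
      (fun j ω => (H'.integral W T ω - H.integral W T ω) -
        (H'.integral W (min (gridTime m j) T) ω - H.integral W (min (gridTime m j) T) ω))]
    congr 1
    by_cases hω : ω ∈ A
    · rw [Set.indicator_of_mem hω]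
      by_cases h3 : gridIndex m (z ω) < (m + 1) ^ 2
      · rw [if_pos ⟨hω, h3⟩]
      · rw [if_neg (fun h => h3 h.2), min_eq_right (hT.trans (le_gridTime_of_le (not_lt.1 h3))),
          sub_self]
    · rw [Set.indicator_of_notMem hω, if_neg (fun h => hω h.1)]

omit [IsProbabilityMeasure P] in
theorem SimplePredictable.measurable_integral (hW : HasCenteredIndepIncrements W 𝓕 P)
    (H : SimplePredictable 𝓕) (T : ℝ≥0) : Measurable (H.integral W T) := by
  have hWm : ∀ t, Measurable (W t) := fun t =>
    ((hW.stronglyMeasurable t).mono (𝓕.le t)).measurable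
  exact Finset.measurable_fun_sum _ fun i _ =>
    ((H.ξ_meas i).mono (𝓕.le _)).measurable.mul ((hWm _).sub (hWm _))

theorem measurable_gridIndex (m : ℕ) : Measurable (gridIndex m) :=
  Nat.measurable_ceil.comp (measurable_id.mul_const _)

theorem measurable_eval_nat_index {φ : ℕ → Ω → ℝ} (h : ∀ j, Measurable (φ j)) {k : Ω → ℕ}
    (hk : Measurable k) : Measurable fun ω => φ (k ω) ω := by
  have h' : Measurable (Function.uncurry φ) := measurable_from_prod_countable_right h
  exact h'.comp (hk.prodMk measurable_id)

theorem measurable_at_gridTime {M : ℝ≥0 → Ω → ℝ} (hM : ∀ t, Measurable (M t)) {z : Ω → ℝ≥0}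
    (hz : Measurable z) (m : ℕ) (T : ℝ≥0) :
    Measurable fun ω => M (min (gridTime m (gridIndex m (z ω))) T) ω :=
  measurable_eval_nat_index (φ := fun j => M (min (gridTime m j) T)) (fun _ => hM _)
    ((measurable_gridIndex m).comp hz)

open Classical in
/-- Pasting two Itô integrals that agree up to a random time, on an event known at that time. -/
theorem IsItoIntegral.paste (hW : HasCenteredIndepIncrements W 𝓕 P)
    (h : IsItoIntegral P 𝓕 W g N) (h' : IsItoIntegral P 𝓕 W g' N')
    (hg : Measurable (Function.uncurry g)) (hg' : Measurable (Function.uncurry g'))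
    {C : ℝ} (hC : ∀ᵐ ω ∂P, ∀ t, |g t ω| ≤ C) (hC' : ∀ᵐ ω ∂P, ∀ t, |g' t ω| ≤ C)
    (hN : ∀ t, Measurable[𝓕 t] (N t)) (hN' : ∀ t, Measurable[𝓕 t] (N' t))
    {A : Set Ω} {z : Ω → ℝ≥0} (hA : ∀ t, MeasurableSet[𝓕 t] (A ∩ {ω | z ω ≤ t}))
    (hz : Measurable z) (hcont : ∀ᵐ ω ∂P, ω ∈ A → Continuous fun t => N' t ω - N t ω)
    (heq : ∀ᵐ ω ∂P, ω ∈ A → ∀ t ≤ z ω, N' t ω = N t ω) :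
    IsItoIntegral P 𝓕 W (fun t ω => if ω ∈ A ∧ z ω < t then g' t ω else g t ω)
      fun t ω => if ω ∈ A then N' t ω else N t ω := by
  have hNm : ∀ t, AEStronglyMeasurable (N t) P := fun t =>
    ((hN t).mono (𝓕.le t) le_rfl).aestronglyMeasurable
  have hNm' : ∀ t, AEStronglyMeasurable (N' t) P := fun t =>
    ((hN' t).mono (𝓕.le t) le_rfl).aestronglyMeasurable
  have hMN := h.isL2Martingale hW hNm
  have hMN' := h'.isL2Martingale hW hNm'
  have hD := hMN'.sub hMN
  have hfib := fun m j => measurableSet_gridIndex_fiber hA m j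
  have hAm : MeasurableSet A := measurableSet_of_fibers (hfib 0)
  obtain ⟨H, hH⟩ := h
  obtain ⟨H', hH'⟩ := h'
  -- A single index governs both the quality of the approximations and the mesh of the grid.
  choose K hKv hKI using fun m => SimplePredictable.exists_paste (W := W) (H m) (H' m) hA m
  refine ⟨K, fun T => ⟨?_, ?_⟩⟩
  · have hub : Filter.Tendsto (fun m : ℕ => 2 * sqDist P T (H m).val g +
        2 * sqDist P T (H' m).val g' +
        2 * ENNReal.ofReal ((2 * C) ^ 2) * ((1 / ((m : ℝ≥0) + 1) : ℝ≥0) : ℝ≥0∞))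
        Filter.atTop (nhds 0) := by
      have h1 : Filter.Tendsto (fun m => sqDist P T (H m).val g) Filter.atTop (nhds 0) := (hH T).1
      have h2 : Filter.Tendsto (fun m => sqDist P T (H' m).val g') Filter.atTop (nhds 0) :=
        (hH' T).1
      have h1 := ENNReal.Tendsto.const_mul (a := 2) h1 (Or.inr ENNReal.ofNat_ne_top)
      have h2 := ENNReal.Tendsto.const_mul (a := 2) h2 (Or.inr ENNReal.ofNat_ne_top)
      have h3 : Filter.Tendsto (fun m : ℕ => ((1 / ((m : ℝ≥0) + 1) : ℝ≥0) : ℝ≥0∞))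
          Filter.atTop (nhds ((0 : ℝ≥0) : ℝ≥0∞)) :=
        ENNReal.tendsto_coe.2 (tendsto_one_div_add_atTop_nhds_zero_nat (𝕜 := ℝ≥0))
      have h4 := ENNReal.Tendsto.const_mul (a := 2 * ENNReal.ofReal ((2 * C) ^ 2)) h3
        (Or.inr (ENNReal.mul_ne_top ENNReal.ofNat_ne_top ENNReal.ofReal_ne_top))
      simpa using (h1.add h2).add h4
    refine tendsto_of_tendsto_of_tendsto_of_le_of_le' tendsto_const_nhds hub
      (.of_forall fun _ => zero_le) ?_
    obtain ⟨n, hn⟩ := exists_nat_ge T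
    filter_upwards [Filter.eventually_ge_atTop n] with m hm
    have hTm : T ≤ m := hn.trans (by exact_mod_cast hm)
    exact sqDist_paste_le hg hg' (H m).measurable_val (H' m).measurable_val hC hC'
      (fun ω => le_gridTime_gridIndex m (z ω)) (fun ω => gridTime_gridIndex_le m (z ω))
      (fun s hs ω => hKv m s (hs.trans hTm) ω)
  · let ρ : ℕ → Ω → ℝ≥0 := fun m ω => min (gridTime m (gridIndex m (z ω))) T
    let a : ℕ → ℝ≥0∞ := fun m => eLpNorm (fun ω => (H m).integral W T ω - N T ω) 2 P
    let a' : ℕ → ℝ≥0∞ := fun m => eLpNorm (fun ω => (H' m).integral W T ω - N' T ω) 2 P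
    let d : ℕ → ℝ≥0∞ := fun m =>
      eLpNorm (fun ω => N' (ρ m ω) ω - N (ρ m ω) ω) 2 (P.restrict A)
    -- The two integrals agree up to `z`. By continuity their difference at the rounded times tends
    -- to its value at `min z T`, which is 0, and the martingale bound upgrades this to mean square.
    have hd : Filter.Tendsto d Filter.atTop (nhds 0) := by
      refine hD.tendsto_eLpNorm_stopped (fun t => (hN' t).sub (hN t))
        (k := fun m ω => gridIndex m (z ω)) (r := gridTime) (hfib) T ?_
      filter_upwards [hcont, heq] with ω h1 h2 hω
      have hlim : Filter.Tendsto (fun m => ρ m ω) Filter.atTop (nhds (min (z ω) T)) :=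
        (tendsto_gridTime_gridIndex (z ω)).min tendsto_const_nhds
      have := ((h1 hω).tendsto (min (z ω) T)).comp hlim
      rw [h2 hω _ (min_le_left _ _), sub_self] at this
      exact this
    have hub : Filter.Tendsto (fun m => a m + (a m + a' m) + ((a m + a' m) + d m))
        Filter.atTop (nhds 0) := by
      have h1 : Filter.Tendsto a Filter.atTop (nhds 0) := (hH T).2
      have h2 : Filter.Tendsto a' Filter.atTop (nhds 0) := (hH' T).2
      simpa using (h1.add (h1.add h2)).add ((h1.add h2).add hd)
    refine tendsto_of_tendsto_of_tendsto_of_le_of_le' tendsto_const_nhds hub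
      (.of_forall fun _ => zero_le) ?_
    obtain ⟨n, hn⟩ := exists_nat_ge T
    filter_upwards [Filter.eventually_ge_atTop n] with m hm
    have hTm : T ≤ m := hn.trans (by exact_mod_cast hm)
    have hI := (H m).isL2Martingale_integral hW
    have hI' := (H' m).isL2Martingale_integral hW
    have hE := (hI'.sub hI).sub hD
    let e₀ : Ω → ℝ := fun ω => (H m).integral W T ω - N T ω
    let e : Ω → ℝ := fun ω => (H' m).integral W T ω - (H m).integral W T ω - (N' T ω - N T ω)
    let f : Ω → ℝ := fun ω => (H' m).integral W (ρ m ω) ω - (H m).integral W (ρ m ω) ω -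
      (N' (ρ m ω) ω - N (ρ m ω) ω)
    let b : Ω → ℝ := fun ω => N' (ρ m ω) ω - N (ρ m ω) ω
    have hIm : ∀ t, Measurable fun ω => (H' m).integral W t ω - (H m).integral W t ω := fun t =>
      ((H' m).measurable_integral hW t).sub ((H m).measurable_integral hW t)
    have hDm : ∀ t, Measurable fun ω => N' t ω - N t ω := fun t =>
      ((hN' t).mono (𝓕.le t) le_rfl).sub ((hN t).mono (𝓕.le t) le_rfl)
    have he₀m : Measurable e₀ :=
      ((H m).measurable_integral hW T).sub ((hN T).mono (𝓕.le T) le_rfl)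
    have hem : Measurable e := (hIm T).sub (hDm T)
    have hbm : Measurable b := measurable_at_gridTime hDm hz m T
    have hfm : Measurable f := (measurable_at_gridTime hIm hz m T).sub hbm
    have hle : eLpNorm e 2 P ≤ a m + a' m := by
      let e' : Ω → ℝ := fun ω => (H' m).integral W T ω - N' T ω
      have he : e = e' - e₀ := by
        funext ω
        simp only [e, e', e₀, Pi.sub_apply]
        ring
      have he'm : Measurable e' :=
        ((H' m).measurable_integral hW T).sub ((hN' T).mono (𝓕.le T) le_rfl)
      rw [he, add_comm]
      exact eLpNorm_sub_le he'm.aestronglyMeasurable he₀m.aestronglyMeasurable one_le_two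
    have hfle : eLpNorm (A.indicator f) 2 P ≤ a m + a' m := by
      rw [eLpNorm_indicator_eq_eLpNorm_restrict hAm]
      exact (hE.eLpNorm_stopped_le (hfib m) T).trans hle
    have hbeq : eLpNorm (A.indicator b) 2 P = d m := eLpNorm_indicator_eq_eLpNorm_restrict hAm
    -- Off `A` only the error `e₀` of `H` is present. On `A`, `e` and `f` are the errors of the
    -- difference integral at `T` and at the rounded time, and `b` is the overshoot of `N' - N`
    -- caused by rounding.
    have hfun : (fun ω => (K m).integral W T ω - if ω ∈ A then N' T ω else N T ω) =
        e₀ + A.indicator e - (A.indicator f + A.indicator b) := by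
      funext ω
      simp only [Pi.add_apply, Pi.sub_apply]
      rw [hKI m T hTm ω]
      by_cases hω : ω ∈ A
      · simp only [Set.indicator_of_mem hω, if_pos hω, e₀, e, f, b, ρ]
        ring
      · simp only [Set.indicator_of_notMem hω, if_neg hω, e₀]
        ring
    have hsm : ∀ {φ : Ω → ℝ}, Measurable φ → AEStronglyMeasurable (A.indicator φ) P :=
      fun hφ => (hφ.indicator hAm).aestronglyMeasurable
    rw [hfun]
    refine (eLpNorm_sub_le (he₀m.aestronglyMeasurable.add (hsm hem))
      ((hsm hfm).add (hsm hbm)) one_le_two).trans (add_le_add ?_ ?_)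
    · exact (eLpNorm_add_le he₀m.aestronglyMeasurable (hsm hem) one_le_two).trans
        (add_le_add le_rfl ((eLpNorm_indicator_le e).trans hle))
    · exact (eLpNorm_add_le (hsm hfm) (hsm hbm) one_le_two).trans
        (add_le_add hfle hbeq.le)

end PasteIntegral

/-! ### Adaptedness and predictability -/

section Adaptedness

theorem measurable_nullCompletion_of_ae_eq {Ω : Type*} {m : MeasurableSpace Ω}
    {𝓕 : Filtration ℝ≥0 m} {P : Measure Ω} {t : ℝ≥0} {f f' : Ω → ℝ} (hf : Measurable f)
    (hf' : Measurable[nullCompletion 𝓕 P t] f') (h : f =ᵐ[P] f') :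
    Measurable[nullCompletion 𝓕 P t] f := by
  have hnull : ∀ N, MeasurableSet N → P N = 0 → MeasurableSet[nullCompletion 𝓕 P t] N :=
    fun N hN hP => (le_sup_right : _ ≤ 𝓕 t ⊔ MeasurableSpace.generateFrom
      {N | MeasurableSet N ∧ P N = 0}) _ (MeasurableSpace.measurableSet_generateFrom ⟨hN, hP⟩)
  have hNm : MeasurableSet {ω | f ω ≠ f' ω} :=
    (measurableSet_eq_fun hf (hf'.mono ((nullCompletion 𝓕 P).le t) le_rfl)).compl
  have hN0 : P {ω | f ω ≠ f' ω} = 0 := h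
  intro S hS
  have he : f ⁻¹' S = (f' ⁻¹' S \ {ω | f ω ≠ f' ω}) ∪ (f ⁻¹' S ∩ {ω | f ω ≠ f' ω}) := by
    ext ω
    by_cases hω : f ω = f' ω <;> simp [hω]
  rw [he]
  exact ((hf' hS).diff (hnull _ hNm hN0)).union
    (hnull _ ((hf hS).inter hNm) (measure_mono_null Set.inter_subset_right hN0))

theorem measurable_intervalIntegral_of_continuous {Ω : Type*} {m : MeasurableSpace Ω}
    {f : ℝ≥0 → Ω → ℝ} (hc : ∀ ω, Continuous fun t => f t ω) {t : ℝ≥0}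
    (hf : ∀ s ≤ t, Measurable (f s)) :
    Measurable fun ω => ∫ s in (0 : ℝ)..t, f s.toNNReal ω := by
  -- Truncating time at `t` leaves the integral unchanged and uses measurability of `f s` only for
  -- `s ≤ t`.
  have hu : Measurable (Function.uncurry fun (s : ℝ) ω => f (min s.toNNReal t) ω) :=
    measurable_uncurry_of_continuous_of_measurable
      (fun ω => (hc ω).comp (continuous_real_toNNReal.min continuous_const))
      (fun s => hf _ (min_le_right _ _))
  have hs : StronglyMeasurable fun x : Ω × ℝ => f (min x.2.toNNReal t) x.1 :=
    (hu.comp measurable_swap).stronglyMeasurable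
  have hi := (hs.integral_prod_right' (ν := volume.restrict (Set.Ioc (0 : ℝ) t))).measurable
  have he : (fun ω => ∫ s in (0 : ℝ)..t, f s.toNNReal ω) =
      fun ω => ∫ s in Set.Ioc (0 : ℝ) t, f (min s.toNNReal t) ω := by
    funext ω
    rw [intervalIntegral.integral_of_le (NNReal.coe_nonneg t)]
    refine setIntegral_congr_fun measurableSet_Ioc fun s hs => ?_
    simp only [min_eq_left (Real.toNNReal_le_iff_le_coe.2 hs.2)]
  rw [he]
  exact hi

theorem MeasureTheory.Filtration.predictable_le_prod {Ω : Type*} {m : MeasurableSpace Ω}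
    (𝓕 : Filtration ℝ≥0 m) : 𝓕.predictable ≤ MeasurableSpace.prod inferInstance m := by
  refine MeasurableSpace.generateFrom_le ?_
  rintro _ (⟨A, hA, rfl⟩ | ⟨i, A, hA, rfl⟩)
  · exact (measurableSet_singleton _).prod (𝓕.le _ _ hA)
  · exact measurableSet_Ioi.prod (𝓕.le _ _ hA)

theorem MeasureTheory.IsStronglyPredictable.measurable_uncurry {Ω : Type*} {m : MeasurableSpace Ω}
    {𝓕 : Filtration ℝ≥0 m} {g : ℝ≥0 → Ω → ℝ} (hg : IsStronglyPredictable 𝓕 g) :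
    Measurable (Function.uncurry g) :=
  (StronglyMeasurable.measurable hg).mono 𝓕.predictable_le_prod le_rfl

open Classical in
/-- Pasting two predictable processes after a random time `z`, on an event known at that time. -/
theorem MeasureTheory.IsStronglyPredictable.paste {Ω : Type*} {m : MeasurableSpace Ω}
    {𝓕 : Filtration ℝ≥0 m} {g g' : ℝ≥0 → Ω → ℝ} (hg : IsStronglyPredictable 𝓕 g)
    (hg' : IsStronglyPredictable 𝓕 g') {A : Set Ω} {z : Ω → ℝ≥0}
    (hA : ∀ t, MeasurableSet[𝓕 t] (A ∩ {ω | z ω ≤ t})) :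
    IsStronglyPredictable 𝓕 fun t ω => if ω ∈ A ∧ z ω < t then g' t ω else g t ω := by
  let D := TopologicalSpace.denseSeq ℝ≥0
  have hset : MeasurableSet[𝓕.predictable] {x : ℝ≥0 × Ω | x.2 ∈ A ∧ z x.2 < x.1} := by
    -- A time of the dense sequence fits between `z` and any later time, which gives a countable
    -- union of predictable rectangles.
    have he : {x : ℝ≥0 × Ω | x.2 ∈ A ∧ z x.2 < x.1} =
        ⋃ n, Set.Ioi (D n) ×ˢ (A ∩ {ω | z ω ≤ D n}) := by
      ext x
      simp only [Set.mem_ofPred_eq, Set.mem_iUnion, Set.mem_prod, Set.mem_Ioi, Set.mem_inter_iff]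
      constructor
      · rintro ⟨h1, h2⟩
        obtain ⟨_, ⟨n, rfl⟩, hn⟩ :=
          (TopologicalSpace.denseRange_denseSeq ℝ≥0).exists_between h2
        exact ⟨n, hn.2, h1, hn.1.le⟩
      · rintro ⟨n, h1, h2, h3⟩
        exact ⟨h2, lt_of_le_of_lt h3 h1⟩
    rw [he]
    exact .iUnion fun n => measurableSet_predictable_Ioi_prod (hA _)
  exact StronglyMeasurable.ite hset hg' hg

end Adaptedness

/-! ### Adaptedness of the sender's posterior and of the signal -/

namespace PersuasionModel

variable {Ω : Type*} [mΩ : MeasurableSpace Ω] {P : Measure Ω} (E : PersuasionModel Ω P)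

theorem measurable_p (t : ℝ≥0) : Measurable[E.senderFiltration t] (E.p t) := by
  refine measurable_nullCompletion_of_ae_eq (E.p_meas t) ?_ (E.p_condExp t)
  refine stronglyMeasurable_condExp.measurable.mono (le_trans ?_ le_sup_left) le_rfl
  refine iSup₂_le fun s hs => ?_
  have hle : MeasurableSpace.comap (fun ω => (E.X s ω, E.BY s ω)) inferInstance ≤
      Filtration.natural (fun t ω => (E.X t ω, E.BY t ω))
        (fun t => ((E.X_meas t).prodMk (E.BY_meas t)).stronglyMeasurable) t :=
    le_iSup₂_of_le (f := fun j (_ : j ≤ t) => MeasurableSpace.comap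
      (fun ω => (E.X j ω, E.BY j ω)) inferInstance) s hs le_rfl
  refine le_trans ?_ hle
  have : Measurable[MeasurableSpace.comap (fun ω => (E.X s ω, E.BY s ω)) inferInstance]
      fun ω => (E.X s ω, E.BY s ω) := comap_measurable _
  exact (measurable_fst.comp this).comap_le

/-- The integrated sender posterior. -/
def drift (t : ℝ≥0) (ω : Ω) : ℝ := ∫ s in (0 : ℝ)..t, E.p s.toNNReal ω

theorem measurable_drift (t : ℝ≥0) : Measurable[E.senderFiltration t] (E.drift t) :=
  @measurable_intervalIntegral_of_continuous _ (E.senderFiltration t) _ E.p_cont _ fun s hs =>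
    (E.measurable_p s).mono (E.senderFiltration.mono hs) le_rfl

theorem continuous_drift (ω : Ω) : Continuous fun t => E.drift t ω := by
  have hc : Continuous fun s : ℝ => E.p s.toNNReal ω :=
    (E.p_cont ω).comp continuous_real_toNNReal
  exact (intervalIntegral.continuous_primitive (fun a b => hc.intervalIntegrable a b) 0).comp
    NNReal.continuous_coe

theorem drift_zero (ω : Ω) : E.drift 0 ω = 0 := by simp [drift]

namespace Policy

variable {E} (π : Policy E)

/-- The noise part of the signal. -/
def noise (t : ℝ≥0) (ω : Ω) : ℝ := π.Y t ω - E.drift t ω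

theorem isItoIntegral_noise : IsItoIntegral P E.senderFiltration E.BY π.g π.noise := π.Y_eq

theorem measurable_noise' (t : ℝ≥0) : Measurable (π.noise t) :=
  (π.Y_meas t).sub ((E.measurable_drift t).mono (E.senderFiltration.le t) le_rfl)

variable [IsProbabilityMeasure P]

/-- The martingale identity with `r = t` shows that the noise equals an `𝓕 t`-measurable variable
almost surely. Completeness of the sender's filtration does the rest. -/
theorem measurable_noise (t : ℝ≥0) : Measurable[E.senderFiltration t] (π.noise t) := by
  have hM := π.isItoIntegral_noise.isL2Martingale E.hasCenteredIndepIncrements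
    fun t => (π.measurable_noise' t).aestronglyMeasurable
  exact measurable_nullCompletion_of_ae_eq (π.measurable_noise' t)
    stronglyMeasurable_condExp.measurable (hM.condExp t t le_rfl).symm

theorem measurable_Y (t : ℝ≥0) : Measurable[E.senderFiltration t] (π.Y t) := by
  have h := (π.measurable_noise t).add (E.measurable_drift t)
  have he : π.noise t + E.drift t = π.Y t := by
    funext ω
    simp [noise]
  rwa [he] at h

theorem signalFiltration_le (t : ℝ≥0) : π.signalFiltration t ≤ E.senderFiltration t :=
  iSup₂_le fun s hs =>
    ((π.measurable_Y s).mono (E.senderFiltration.mono hs) le_rfl).comap_le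

omit [IsProbabilityMeasure P] in
theorem Y_zero : ∀ᵐ ω ∂P, π.Y 0 ω = 0 := by
  filter_upwards [π.isItoIntegral_noise.ae_eq_zero
    (π.measurable_noise' 0).aestronglyMeasurable] with ω hω
  simpa [noise, E.drift_zero] using hω

theorem integrable_payoff : Integrable π.payoff P := by
  refine Integrable.sub ?_ π.cost_int
  refine (integrable_const (1 : ℝ)).indicator ?_
  have : Measurable π.posterior :=
    stronglyMeasurable_condExp.measurable.mono π.τ_isStoppingTime.measurableSpace_le le_rfl
  exact measurableSet_le measurable_const this

theorem integrable_high : Integrable E.high P :=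
  (integrable_const (1 : ℝ)).indicator (E.state_meas (measurableSet_singleton _))

end Policy

end PersuasionModel

/-! ### The switched policy and its payoff -/

namespace PersuasionModel

variable {Ω : Type*} [mΩ : MeasurableSpace Ω] {P : Measure Ω} {E : PersuasionModel Ω P}

/-- The data for switching from `π` to `π'` at the stopping time `ζ` on the event `A`. The paths
behave regularly outside of the null event `N`. -/
structure SwitchData (π π' : Policy E) where
  ζ : Ω → WithTop ℝ≥0
  hζ : IsStoppingTime π.signalFiltration ζ
  A : Set Ω
  hA : MeasurableSet[hζ.measurableSpace] A
  lt_of_mem : ∀ ω ∈ A, ζ ω < π.τ ω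
  N : Set Ω
  hN : MeasurableSet N
  measure_N : P N = 0
  Y_eq : ∀ ω ∉ N, ∀ t : ℝ≥0, t ≤ ζ ω → π'.Y t ω = π.Y t ω
  min_eq : ∀ ω ∉ N, min (π'.τ ω) (ζ ω) = min (π.τ ω) (ζ ω)
  Y_zero : ∀ ω ∉ N, π.Y 0 ω = 0
  Y_zero' : ∀ ω ∉ N, π'.Y 0 ω = 0

namespace SwitchData

variable {π π' : Policy E} (S : SwitchData π π')

theorem measurableSet_A : MeasurableSet S.A := S.hζ.measurableSpace_le _ S.hA

theorem zeta_le (ω : Ω) (hω : ω ∈ S.A) (hN : ω ∉ S.N) : S.ζ ω ≤ π'.τ ω := by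
  have h := S.min_eq ω hN
  rw [min_eq_right (S.lt_of_mem ω hω).le] at h
  exact h ▸ min_le_left _ _

theorem mem_of_agree {ω ω' : Ω} (hω : ω ∈ S.A) (h : AgreeUpTo π.Y (S.ζ ω) ω ω') : ω' ∈ S.A :=
  S.hζ.mem_of_agreeUpTo S.hA h hω

/-- The real value of the switching time. -/
def z (ω : Ω) : ℝ≥0 := (S.ζ ω).untopD 0

theorem coe_z {ω : Ω} (hω : ω ∈ S.A) : (S.z ω : WithTop ℝ≥0) = S.ζ ω := by
  obtain ⟨x, hx⟩ := WithTop.ne_top_iff_exists.1 (S.lt_of_mem ω hω).ne_top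
  rw [z, ← hx, WithTop.untopD_coe]

theorem measurable_z : Measurable S.z :=
  (S.hζ.measurable.mono S.hζ.measurableSpace_le le_rfl).untopD 0

open Classical in
/-- The signal after switching; the exceptional event is marked by a signal that starts at `1`. -/
def Y (t : ℝ≥0) (ω : Ω) : ℝ := if ω ∈ S.N then 1 else if ω ∈ S.A then π'.Y t ω else π.Y t ω

open Classical in
/-- The terminal time after switching. -/
def τ (ω : Ω) : WithTop ℝ≥0 :=
  if ω ∈ S.N then ((0 : ℝ≥0) : WithTop ℝ≥0) else if ω ∈ S.A then π'.τ ω else π.τ ω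

open Classical in
/-- The garbling after switching. -/
def g (t : ℝ≥0) (ω : Ω) : ℝ := if ω ∈ S.A ∧ S.z ω < t then π'.g t ω else π.g t ω

section values

variable {S} {ω : Ω} {t : ℝ≥0}

theorem Y_of_mem_N (h : ω ∈ S.N) : S.Y t ω = 1 := if_pos h

theorem Y_of_mem (hN : ω ∉ S.N) (h : ω ∈ S.A) : S.Y t ω = π'.Y t ω := by
  rw [Y, if_neg hN, if_pos h]

theorem Y_of_notMem (hN : ω ∉ S.N) (h : ω ∉ S.A) : S.Y t ω = π.Y t ω := by
  rw [Y, if_neg hN, if_neg h]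

theorem tau_of_mem_N (h : ω ∈ S.N) : S.τ ω = ((0 : ℝ≥0) : WithTop ℝ≥0) := if_pos h

theorem tau_of_mem (hN : ω ∉ S.N) (h : ω ∈ S.A) : S.τ ω = π'.τ ω := by
  rw [τ, if_neg hN, if_pos h]

theorem tau_of_notMem (hN : ω ∉ S.N) (h : ω ∉ S.A) : S.τ ω = π.τ ω := by
  rw [τ, if_neg hN, if_neg h]

theorem switch_Y_zero (hN : ω ∉ S.N) : S.Y 0 ω = 0 := by
  by_cases h : ω ∈ S.A
  · rw [Y_of_mem hN h, S.Y_zero' ω hN]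
  · rw [Y_of_notMem hN h, S.Y_zero ω hN]

end values

theorem measurable_Y (t : ℝ≥0) : Measurable (S.Y t) :=
  Measurable.ite S.hN measurable_const
    (Measurable.ite S.measurableSet_A (π'.Y_meas t) (π.Y_meas t))

theorem continuous_Y (ω : Ω) : Continuous fun t => S.Y t ω := by
  by_cases hN : ω ∈ S.N
  · simpa only [Y_of_mem_N hN] using continuous_const
  · by_cases hA : ω ∈ S.A
    · simpa only [Y_of_mem hN hA] using π'.Y_cont ω
    · simpa only [Y_of_notMem hN hA] using π.Y_cont ω

theorem measurable_tau : Measurable S.τ :=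
  Measurable.ite S.hN measurable_const (Measurable.ite S.measurableSet_A
    (π'.τ_isStoppingTime.measurable.mono π'.τ_isStoppingTime.measurableSpace_le le_rfl)
    (π.τ_isStoppingTime.measurable.mono π.τ_isStoppingTime.measurableSpace_le le_rfl))

theorem ae_notMem_N : ∀ᵐ ω ∂P, ω ∉ S.N := measure_eq_zero_iff_ae_notMem.1 S.measure_N

/-- Outside of `N`, paths inside and outside of `A` separate before the switching time. -/
theorem not_agree_of_le {ω ω' : Ω} (hN : ω ∉ S.N) (hN' : ω' ∉ S.N) (hA : ω ∈ S.A) (hA' : ω' ∉ S.A)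
    {T : WithTop ℝ≥0} (hT : S.ζ ω ≤ T) : ¬ AgreeUpTo S.Y T ω ω' := by
  intro h
  refine hA' (S.mem_of_agree hA fun s hs => ?_)
  have := h s (hs.trans hT)
  rwa [Y_of_mem hN hA, Y_of_notMem hN' hA', S.Y_eq ω hN s hs] at this

/-- The value at time 0 gives the exceptional event away: regular paths start at 0 and marked ones
at 1. -/
theorem notMem_N_of_agree {ω ω' : Ω} (hN : ω ∉ S.N) {t : WithTop ℝ≥0}
    (h : AgreeUpTo S.Y t ω ω') : ω' ∉ S.N := by
  intro hN'
  have h0 := h 0 (bot_le : (⊥ : WithTop ℝ≥0) ≤ t)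
  rw [switch_Y_zero hN, Y_of_mem_N hN'] at h0
  exact zero_ne_one h0

theorem measurableSet_inter_z_le [IsProbabilityMeasure P] (t : ℝ≥0) :
    MeasurableSet[E.senderFiltration t] (S.A ∩ {ω | S.z ω ≤ t}) := by
  have he : S.A ∩ {ω | S.z ω ≤ t} = S.A ∩ {ω | S.ζ ω ≤ t} := by
    ext ω
    refine and_congr_right fun hω => ?_
    rw [Set.mem_ofPred_eq, Set.mem_ofPred_eq, ← S.coe_z hω, WithTop.coe_le_coe]
  rw [he]
  exact π.signalFiltration_le t _ (S.hA.2 t)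

theorem isItoIntegral [IsProbabilityMeasure P] : IsItoIntegral P E.senderFiltration E.BY S.g
    fun t ω => S.Y t ω - E.drift t ω := by
  classical
  obtain ⟨K, -, hK⟩ := π.g_bdd
  obtain ⟨K', -, hK'⟩ := π'.g_bdd
  have hpaste := π.isItoIntegral_noise.paste (C := max K K') E.hasCenteredIndepIncrements
    π'.isItoIntegral_noise π.g_pred.measurable_uncurry π'.g_pred.measurable_uncurry
    (hK.mono fun ω h t => (h t).trans (le_max_left _ _))
    (hK'.mono fun ω h t => (h t).trans (le_max_right _ _))
    π.measurable_noise π'.measurable_noise (A := S.A) (z := S.z) ?_ S.measurable_z ?_ ?_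
  · refine hpaste.congr fun t => ?_
    filter_upwards [S.ae_notMem_N] with ω hN
    by_cases hA : ω ∈ S.A
    · simp only [if_pos hA, Y_of_mem hN hA, Policy.noise]
    · simp only [if_neg hA, Y_of_notMem hN hA, Policy.noise]
  · exact S.measurableSet_inter_z_le
  · refine .of_forall fun ω _ => ?_
    exact ((π'.Y_cont ω).sub (E.continuous_drift ω)).sub
      ((π.Y_cont ω).sub (E.continuous_drift ω))
  · filter_upwards [S.ae_notMem_N] with ω hN hA t ht
    have : (t : WithTop ℝ≥0) ≤ S.ζ ω := S.coe_z hA ▸ WithTop.coe_le_coe.2 ht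
    simp only [Policy.noise, S.Y_eq ω hN t this]

variable [StandardBorelSpace Ω]

/-- By Galmarino's test it suffices to compare two paths that agree up to `t`. A pair split by `A`
cannot agree as far as `ζ`. If it agrees only up to `t ≤ ζ`, then `π` would stop by `t` on the
outcome in `A`, against `ζ < τ` there. -/
theorem isStoppingTime_tau : IsStoppingTime
    (Filtration.natural S.Y fun t => (S.measurable_Y t).stronglyMeasurable) S.τ := by
  refine isStoppingTime_natural_of_agreeUpTo S.continuous_Y
    (fun t => S.measurable_tau measurableSet_Iic) fun t ω ω' h hω => ?_
  by_cases hN : ω ∈ S.N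
  · by_cases hN' : ω' ∈ S.N
    · rw [tau_of_mem_N hN']
      exact WithTop.coe_le_coe.2 bot_le
    · exact absurd hN (S.notMem_N_of_agree hN' h.symm)
  have hN' := S.notMem_N_of_agree hN h
  by_cases hA : ω ∈ S.A <;> by_cases hA' : ω' ∈ S.A
  · rw [tau_of_mem hN hA] at hω
    rw [tau_of_mem hN' hA']
    refine mem_of_agreeUpTo_of_natural (π'.τ_isStoppingTime t) (fun s hs => ?_) hω
    simpa only [Y_of_mem hN hA, Y_of_mem hN' hA'] using h s hs
  · rw [tau_of_mem hN hA] at hω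
    exact absurd h (S.not_agree_of_le hN hN' hA hA' ((S.zeta_le ω hA hN).trans hω))
  · rcases le_total (S.ζ ω') t with hle | hle
    · exact absurd h.symm (S.not_agree_of_le hN' hN hA' hA hle)
    · rw [tau_of_notMem hN hA] at hω
      have h' : π.τ ω' ≤ t := by
        refine mem_of_agreeUpTo_of_natural (π.τ_isStoppingTime t) (fun s hs => ?_) hω
        have := h s hs
        rwa [Y_of_notMem hN hA, Y_of_mem hN' hA', S.Y_eq ω' hN' s (hs.trans hle)] at this
      exact absurd (S.lt_of_mem ω' hA') (not_lt.2 (h'.trans hle))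
  · rw [tau_of_notMem hN hA] at hω
    rw [tau_of_notMem hN' hA']
    refine mem_of_agreeUpTo_of_natural (π.τ_isStoppingTime t) (fun s hs => ?_) hω
    simpa only [Y_of_notMem hN hA, Y_of_notMem hN' hA'] using h s hs

variable [IsProbabilityMeasure P]

/-- The policy that switches from `π` to `π'` at time `ζ` on the event `A`. -/
def policy : Policy E where
  g := S.g
  g_pred := π.g_pred.paste π'.g_pred S.measurableSet_inter_z_le
  g_bdd := by
    obtain ⟨K, hKM, hK⟩ := π.g_bdd
    obtain ⟨K', hKM', hK'⟩ := π'.g_bdd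
    refine ⟨max K K', by rw [ENNReal.coe_max]; exact max_le hKM hKM', ?_⟩
    filter_upwards [hK, hK'] with ω h h' t
    rw [g]
    split_ifs
    · exact (h' t).trans (NNReal.coe_le_coe.2 (le_max_right _ _))
    · exact (h t).trans (NNReal.coe_le_coe.2 (le_max_left _ _))
  Y := S.Y
  Y_meas := S.measurable_Y
  Y_cont := S.continuous_Y
  Y_eq := S.isItoIntegral
  τ := S.τ
  τ_isStoppingTime := S.isStoppingTime_tau
  τ_finite := by
    filter_upwards [S.ae_notMem_N, π.τ_finite, π'.τ_finite] with ω hN h h'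
    by_cases hA : ω ∈ S.A
    · rwa [tau_of_mem hN hA]
    · rwa [tau_of_notMem hN hA]
  cost_int := by
    classical
    refine (Integrable.piecewise S.measurableSet_A π'.cost_int.integrableOn
      π.cost_int.integrableOn).congr ?_
    filter_upwards [S.ae_notMem_N] with ω hN
    by_cases hA : ω ∈ S.A
    · rw [Set.piecewise_eq_of_mem _ _ _ hA, tau_of_mem hN hA]
    · rw [Set.piecewise_eq_of_notMem _ _ _ hA, tau_of_notMem hN hA]

theorem policy_tau (ω : Ω) : S.policy.τ ω = S.τ ω := rfl

theorem posterior_of_mem : ∀ᵐ ω ∂P, ω ∈ S.A → S.policy.posterior ω = π'.posterior ω := by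
  refine condExp_stopping_ae_eq_on_of_agreeUpTo S.continuous_Y π'.Y_cont
    S.isStoppingTime_tau π'.τ_isStoppingTime S.measurableSet_A S.hN S.measure_N
    (fun ω hA hN => tau_of_mem hN hA) (fun ω hA hN s _ => Y_of_mem hN hA) ?_ ?_
    Policy.integrable_high
  · intro ω hA hN ω' hN' h
    by_contra hA'
    refine S.not_agree_of_le hN hN' hA hA' ?_ h
    rw [tau_of_mem hN hA]
    exact S.zeta_le ω hA hN
  · intro ω hA hN ω' hN' h
    have h' : AgreeUpTo π'.Y (S.ζ ω) ω ω' := h.mono (S.zeta_le ω hA hN)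
    -- `ζ` is a stopping time of the signal of `π`, not of `π'`. Off `N` the two signals coincide up
    -- to `ζ`, so agreement can be transferred up to the smaller of the two values of `ζ`.
    rcases le_total (S.ζ ω) (S.ζ ω') with hle | hle
    · refine S.mem_of_agree hA fun s hs => ?_
      rw [← S.Y_eq ω hN s hs, ← S.Y_eq ω' hN' s (hs.trans hle), h' s hs]
    · have h'' : AgreeUpTo π.Y (S.ζ ω') ω' ω := fun s hs => by
        rw [← S.Y_eq ω' hN' s hs, ← S.Y_eq ω hN s (hs.trans hle), h' s (hs.trans hle)]
      have he := S.hζ.eq_of_agreeUpTo h''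
      exact S.mem_of_agree hA (he ▸ h''.symm)

theorem posterior_of_notMem : ∀ᵐ ω ∂P, ω ∈ S.Aᶜ → S.policy.posterior ω = π.posterior ω := by
  refine condExp_stopping_ae_eq_on_of_agreeUpTo S.continuous_Y π.Y_cont
    S.isStoppingTime_tau π.τ_isStoppingTime S.measurableSet_A.compl S.hN S.measure_N
    (fun ω hA hN => tau_of_notMem hN hA) (fun ω hA hN s _ => Y_of_notMem hN hA) ?_ ?_
    Policy.integrable_high
  · intro ω hA hN ω' hN' h hA'
    rw [tau_of_notMem hN hA] at h
    rcases le_total (S.ζ ω') (π.τ ω) with hle | hle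
    · exact S.not_agree_of_le hN' hN hA' hA hle h.symm
    · have h' : AgreeUpTo π.Y (π.τ ω) ω ω' := fun s hs => by
        have := h s hs
        rwa [Y_of_notMem hN hA, Y_of_mem hN' hA', S.Y_eq ω' hN' s (hs.trans hle)] at this
      have he := π.τ_isStoppingTime.eq_of_agreeUpTo h'
      exact absurd (S.lt_of_mem ω' hA') (not_lt.2 (he ▸ hle))
  · intro ω hA hN ω' hN' h hA'
    have he : π.τ ω' = π.τ ω := π.τ_isStoppingTime.eq_of_agreeUpTo h
    exact hA (S.mem_of_agree hA' (h.symm.mono (he ▸ (S.lt_of_mem ω' hA').le)))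

theorem payoff_of_mem : ∀ᵐ ω ∂P, ω ∈ S.A → S.policy.payoff ω = π'.payoff ω := by
  filter_upwards [S.posterior_of_mem, S.ae_notMem_N] with ω h hN hA
  simp only [Policy.payoff, Set.indicator, Set.mem_ofPred_eq, h hA, policy_tau, tau_of_mem hN hA]

theorem payoff_of_notMem : ∀ᵐ ω ∂P, ω ∈ S.Aᶜ → S.policy.payoff ω = π.payoff ω := by
  filter_upwards [S.posterior_of_notMem, S.ae_notMem_N] with ω h hN hA
  simp only [Policy.payoff, Set.indicator, Set.mem_ofPred_eq, h hA, policy_tau,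
    tau_of_notMem hN hA]

theorem U_policy : S.policy.U = π.U + ((∫ ω in S.A, π'.payoff ω ∂P) - ∫ ω in S.A, π.payoff ω ∂P) :=
    by
  rw [Policy.U, Policy.U, ← integral_add_compl S.measurableSet_A S.policy.integrable_payoff,
    ← integral_add_compl S.measurableSet_A π.integrable_payoff,
    setIntegral_congr_ae S.measurableSet_A S.payoff_of_mem,
    setIntegral_congr_ae S.measurableSet_A.compl S.payoff_of_notMem]
  ring

end SwitchData

/-! ### Global optimality implies sequential optimality -/

theorem Policy.U_le_globalValue (π : Policy E) : ((π.U : ℝ) : EReal) ≤ E.globalValue :=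
  le_iSup (fun π : Policy E => ((π.U : ℝ) : EReal)) π

theorem Policy.GloballyOptimal.U_le {π : Policy E} (h : π.GloballyOptimal) (π' : Policy E) :
    π'.U ≤ π.U := by
  have h' := π'.U_le_globalValue
  rw [← h] at h'
  exact EReal.coe_le_coe_iff.1 h'

variable [StandardBorelSpace Ω] [IsProbabilityMeasure P]

theorem Policy.GloballyOptimal.sequentiallyOptimal {π : Policy E} (h : π.GloballyOptimal) :
    π.SequentiallyOptimal := by
  intro ζ hζ π' hco
  let b : Ω → ℝ := P[π'.payoff | hζ.measurableSpace]
  let a : Ω → ℝ := P[π.payoff | hζ.measurableSpace]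
  have hb : StronglyMeasurable[hζ.measurableSpace] b := stronglyMeasurable_condExp
  have ha : StronglyMeasurable[hζ.measurableSpace] a := stronglyMeasurable_condExp
  -- The event where deviating pays strictly. It is known at `ζ`, so a policy may condition on it,
  -- and the conditional expectations may be integrated over it.
  let A : Set Ω := {ω | a ω < b ω} ∩ {ω | π.τ ω ≤ ζ ω}ᶜ
  have hA : MeasurableSet[hζ.measurableSpace] A :=
    (@measurableSet_lt _ _ _ _ _ hζ.measurableSpace _ _ _ _ _ ha.measurable hb.measurable).inter
      (IsStoppingTime.measurableSet_stopping_time_le π.τ_isStoppingTime hζ).compl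
  have hgood : ∀ᵐ ω ∂P, ((∀ t : ℝ≥0, (t : WithTop ℝ≥0) ≤ ζ ω → π'.Y t ω = π.Y t ω) ∧
      min (π'.τ ω) (ζ ω) = min (π.τ ω) (ζ ω)) ∧ π.Y 0 ω = 0 ∧ π'.Y 0 ω = 0 :=
    hco.and (π.Y_zero.and π'.Y_zero)
  obtain ⟨N, hsub, hN, hN0⟩ := exists_measurable_superset_of_null (ae_iff.1 hgood)
  have hout := fun ω (hω : ω ∉ N) => not_not.1 fun h => hω (hsub h)
  let S : SwitchData π π' :=
    { ζ, hζ, A, hA, N, hN, measure_N := hN0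
      lt_of_mem := fun ω hω => not_le.1 hω.2
      Y_eq := fun ω hω => (hout ω hω).1.1
      min_eq := fun ω hω => (hout ω hω).1.2
      Y_zero := fun ω hω => (hout ω hω).2.1
      Y_zero' := fun ω hω => (hout ω hω).2.2 }
  have hU := h.U_le S.policy
  rw [S.U_policy] at hU
  have hAm : MeasurableSet A := S.measurableSet_A
  have hle : ∫ ω in A, (b ω - a ω) ∂P ≤ 0 := by
    rw [integral_sub integrable_condExp.integrableOn integrable_condExp.integrableOn,
      setIntegral_condExp hζ.measurableSpace_le π'.integrable_payoff hA,
      setIntegral_condExp hζ.measurableSpace_le π.integrable_payoff hA]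
    have : S.A = A := rfl
    rw [this] at hU
    linarith
  have hnn : 0 ≤ᵐ[P.restrict A] fun ω => b ω - a ω :=
    (ae_restrict_mem hAm).mono fun ω hω => (sub_pos.2 hω.1).le
  have hz := (integral_eq_zero_iff_of_nonneg_ae hnn
    (integrable_condExp.integrableOn.sub integrable_condExp.integrableOn)).1
    (le_antisymm hle (integral_nonneg_of_ae hnn))
  filter_upwards [ae_imp_of_ae_restrict hz] with ω hω hlt
  by_contra! hab
  have hmem : ω ∈ A := ⟨hab, not_le.2 hlt⟩
  have h0 : b ω - a ω = 0 := hω hmem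
  exact absurd h0 (sub_pos.2 hab).ne'

end PersuasionModel

/-! ### Equality of values implies existence of an optimum -/

namespace PersuasionModel

variable {Ω : Type*} [mΩ : MeasurableSpace Ω] {P : Measure Ω} {E : PersuasionModel Ω P}

/-- The policy that never garbles and stops immediately. -/
def immediatePolicy (E : PersuasionModel Ω P) [IsFiniteMeasure P] : Policy E where
  g := fun _ _ => 0
  g_pred := stronglyMeasurable_const
  g_bdd := ⟨0, by simp, by simp⟩
  Y := E.drift
  Y_meas t := (E.measurable_drift t).mono (E.senderFiltration.le t) le_rfl
  Y_cont := E.continuous_drift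
  Y_eq := by
    refine ⟨fun _ => ⟨0, fun _ => 0, monotone_const, fun _ _ => 0, fun _ =>
      stronglyMeasurable_const, fun _ => ⟨0, by simp⟩⟩, fun T => ⟨?_, ?_⟩⟩
    · simp [SimplePredictable.val]
    · simp [SimplePredictable.integral, drift]
  τ := fun _ => ((0 : ℝ≥0) : WithTop ℝ≥0)
  τ_isStoppingTime := isStoppingTime_const _ _
  τ_finite := by simp
  cost_int := integrable_const _

namespace Policy

/-- All signals start at 0 almost surely, so sequential optimality at time 0 compares with every
policy. -/
theorem coincidesUpTo_zero [IsProbabilityMeasure P] (π' π : Policy E) :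
    π'.CoincidesUpTo π fun _ => ((0 : ℝ≥0) : WithTop ℝ≥0) := by
  filter_upwards [π.Y_zero, π'.Y_zero] with ω h h'
  refine ⟨fun t ht => ?_, ?_⟩
  · obtain rfl : t = 0 := by simpa using WithTop.coe_le_coe.1 ht
    rw [h, h']
  · have hbot (x : WithTop ℝ≥0) : ((0 : ℝ≥0) : WithTop ℝ≥0) ≤ x := bot_le (a := x)
    rw [min_eq_right (hbot _), min_eq_right (hbot _)]

variable [IsProbabilityMeasure P]

/-- Stopping at once reveals nothing and costs nothing: the posterior is the prior. The payoff is
therefore the same for all such policies. -/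
theorem U_eq_of_tau_eq_zero {π : Policy E} (h : ∀ᵐ ω ∂P, π.τ ω = ((0 : ℝ≥0) : WithTop ℝ≥0)) :
    π.U = if E.Pbar ≤ ∫ ω, E.high ω ∂P then 1 else 0 := by
  have hpost : π.posterior =ᵐ[P] fun _ => ∫ ω, E.high ω ∂P :=
    condExp_stopping_ae_eq_integral π.τ_isStoppingTime h π.Y_zero integrable_high
  have hpay : π.payoff =ᵐ[P] fun _ => if E.Pbar ≤ ∫ ω, E.high ω ∂P then 1 else 0 := by
    filter_upwards [hpost, h] with ω hω hτ
    simp [payoff, Set.indicator, hω, hτ, E.c_zero]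
  rw [U, integral_congr_ae hpay]
  simp

/-- At `ζ = 0` conditional payoffs are plain expectations. If another policy were strictly better,
the sequential inequality would fail wherever `0 < τ`, which forces `τ = 0` almost surely. -/
theorem SequentiallyOptimal.globallyOptimal {π : Policy E} (h : π.SequentiallyOptimal)
    (h0 : ¬ ∀ᵐ ω ∂P, π.τ ω = ((0 : ℝ≥0) : WithTop ℝ≥0)) : π.GloballyOptimal := by
  refine le_antisymm π.U_le_globalValue (iSup_le fun π' => EReal.coe_le_coe_iff.2 ?_)
  have hζ : IsStoppingTime π.signalFiltration fun _ : Ω => ((0 : ℝ≥0) : WithTop ℝ≥0) :=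
    isStoppingTime_const _ _
  have hcond {f : Ω → ℝ} (hf : Integrable f P) :
      P[f | hζ.measurableSpace] =ᵐ[P] fun _ => ∫ ω, f ω ∂P :=
    condExp_stopping_ae_eq_integral hζ (.of_forall fun _ => rfl) π.Y_zero hf
  by_contra hlt
  refine h0 ?_
  filter_upwards [h _ hζ π' (π'.coincidesUpTo_zero π), hcond π.integrable_payoff,
    hcond π'.integrable_payoff] with ω hω h1 h2
  by_contra hne
  refine hlt ?_
  have := hω (lt_of_le_of_ne (bot_le (a := π.τ ω)) (Ne.symm hne))
  rwa [h1, h2] at this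

end Policy

theorem localValue_le_globalValue : E.localValue ≤ E.globalValue :=
  iSup₂_le fun π _ => π.U_le_globalValue

theorem exists_globallyOptimal_of_globalValue_eq_localValue [IsProbabilityMeasure P]
    (h : E.globalValue = E.localValue) : ∃ π : Policy E, π.GloballyOptimal := by
  by_contra! hno
  refine hno E.immediatePolicy (le_antisymm (E.immediatePolicy.U_le_globalValue) ?_)
  rw [h]
  -- This also covers the absence of sequentially optimal policies, where the local value is `⊥`.
  refine iSup₂_le fun π hπ => EReal.coe_le_coe_iff.2 (le_of_eq ?_)
  rw [Policy.U_eq_of_tau_eq_zero (by_contra fun h0 => hno π (hπ.globallyOptimal h0)),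
    Policy.U_eq_of_tau_eq_zero (.of_forall fun _ => rfl)]

theorem Policy.GloballyOptimal.globalValue_eq_localValue [StandardBorelSpace Ω]
    [IsProbabilityMeasure P] {π : Policy E} (h : π.GloballyOptimal) :
    E.globalValue = E.localValue := by
  refine le_antisymm (h.ge.trans ?_) E.localValue_le_globalValue
  exact le_iSup₂ (f := fun (π : Policy E) (_ : π.SequentiallyOptimal) => ((π.U : ℝ) : EReal)) π
    h.sequentiallyOptimal

end PersuasionModel
end

theorem proposition6 {Ω : Type*} [MeasurableSpace Ω] [StandardBorelSpace Ω]
    (P : Measure Ω) [IsProbabilityMeasure P] (E : PersuasionModel Ω P) :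
    (∀ π : PersuasionModel.Policy E, π.GloballyOptimal → π.SequentiallyOptimal) ∧
      (E.globalValue = E.localValue ↔ ∃ π : PersuasionModel.Policy E, π.GloballyOptimal) :=
  ⟨fun _ h => h.sequentiallyOptimal,
    PersuasionModel.exists_globallyOptimal_of_globalValue_eq_localValue,
    fun ⟨_, h⟩ => h.globalValue_eq_localValue⟩
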